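/- **Conventions.** Let $M$ be a smooth manifold (Hausdorff, second countable, finite-dimensional), possibly with boundary, and let $I=[0,1]$. For $A\subseteq X\subseteq M\times I^k$ put $\mathrm{Cyl}(X,A):=X\times\{0\}\,\cup\,A\times I\subseteq X\times I\subseteq M\times I^{k+1}$. *Manifolds with cylinders* over $M$ are the subsets of $M\times I^k$ ($k\ge 0$) obtained inductively as follows: every closed neat submanifold of $M$ (including $\emptyset$ and $M$) is one, with $k=0$; if $X,A\subseteq M\times I^k$ are manifolds with cylinders and $A\subseteq X$, then so is $\mathrm{Cyl}(X,A)$, and so is $\mathrm{Cyl}(X,A)\cup D\times\{1\}$ for every manifold with cylinders $D\subseteq M\times I^k$ with $A\subseteq D$. (A submanifold $N$ is neat if $\partial N=N\cap\partial M$ and $N$ is transverse to $\partial M$; for $\partial M=\emptyset$ the closed neat submanifolds are the closed embedded submanifolds without boundary.) A *pair of manifolds with cylinders* $(X,A)$ consists of two manifolds with cylinders $A\subseteq X\subseteq M\times I^k$ over the same $M$. Let $Y$ be a topological space, $V^\bullet=(V^q)_{q\in\mathbb Z}$ a graded real vector space, $n\in\mathbb Z$, and $\kappa_n\in C^n(Y;V^\bullet)=\prod_{p+q=n}C^p(Y;V^q)$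 a singular cocycle. For a subset $S\subseteq M\times I^k$ with projection $\pi:S\to M$, let $C^n(S;V^\bullet)=\prod_{p+q=n}C^p(S;V^q)$ denote the smooth singular cochains of $S$, i.e. the cochains on those singular simplices of $S$ that are smooth as maps to $M\times\mathbb R^k$. A *differential function* $(f,h,\pi^*\omega):S\to(Y,\kappa_n)$ consists of a continuous map $f:S\to Y$, a cochain $h\in C^{n-1}(S;V^\bullet)$ and a closed form $\omega\in\Omega^n_{cl}(M;V^\bullet)=\prod_{p+q=n}\Omega^p_{cl}(M;V^q)$ such that $$\delta h=\chi(\pi^*\omega)-f^*\kappa_n ,$$ where $\chi(\pi^*\omega)$ is the cochain which integrates $\pi^*\omega$ over smooth simplices, and $f^*\kappa_n$ is evaluated on smooth simplices. (Forms with values in $V^q$ are assumed to take values, locally, in a finite-dimensional subspace.) A differential function on $X\times I$ with curvature pulled back from the base is a homotopy of differential functions on $X$. **Lemma 4.1 (HEP).** Let $(X,A)$ be a pair of manifolds with cylinders. Then the homotopy extension property holds for differential functions: for every differential function $(f,h,\pi^*\omega):\mathrm{Cyl}(X,A)\to(Y,\kappa_n)$ there is a homotopy $(F,H,\pi^*\omega):X\times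 I\to(Y,\kappa_n)$, with the same form $\omega$ on $M$, which extends it, i.e. $F|_{\mathrm{Cyl}(X,A)}=f$ and $H|_{\mathrm{Cyl}(X,A)}=h$. -/

import Mathlib

open Set MeasureTheory
open scoped Manifold ContDiff

noncomputable section

namespace DiffHEP

/-! ### Graded singular cochains -/

/-- Cochains of total degree `n` with values in the graded vector space `V`, on a graded set of
simplices `Simp`: the product over all `p + q = n` of the functions `Simp p → V q`. -/
def Cochain (Simp : ℕ → Type*) (V : ℤ → Type*) (n : ℤ) : Type _ :=
  ∀ (p : ℕ) (q : ℤ), (p : ℤ) + q = n → Simp p → V q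

/-- The coboundary `(δ c)(σ) = ∑ i, (-1) ^ i • c (d_i σ)` with respect to the face maps `face`. -/
def coboundary {Simp : ℕ → Type*} {V : ℤ → Type*} [∀ q, AddCommGroup (V q)]
    (face : ∀ p : ℕ, Fin (p + 2) → Simp (p + 1) → Simp p) {n : ℤ} (c : Cochain Simp V n) :
    Cochain Simp V (n + 1)
  | 0, _, _, _ => 0
  | p + 1, q, hpq, σ =>
      ∑ i : Fin (p + 2), ((-1 : ℤ) ^ (i : ℕ)) • c p q (by push_cast at hpq; omega) (face p i σ)

/-- The inclusion of the `i`-th face of the standard `(p + 1)`-simplex. -/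
def faceIncl (p : ℕ) (i : Fin (p + 2)) :
    C(stdSimplex ℝ (Fin (p + 1)), stdSimplex ℝ (Fin (p + 2))) :=
  ⟨stdSimplex.map i.succAbove, stdSimplex.continuous_map _⟩

/-- Singular `p`-simplices of a topological space. -/
abbrev SingularSimplex (Y : Type*) [TopologicalSpace Y] (p : ℕ) : Type _ :=
  C(stdSimplex ℝ (Fin (p + 1)), Y)

/-- The faces of a singular simplex. -/
def singularFace (Y : Type*) [TopologicalSpace Y] (p : ℕ) (i : Fin (p + 2))
    (σ : SingularSimplex Y (p + 1)) : SingularSimplex Y p :=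
  σ.comp (faceIncl p i)

/-- `Cⁿ(Y; V)`: singular cochains of total degree `n` of the topological space `Y`. -/
abbrev SingularCochain (Y : Type*) [TopologicalSpace Y] (V : ℤ → Type*) (n : ℤ) : Type _ :=
  Cochain (SingularSimplex Y) V n

/-- The singular cocycles: `δ κ = 0`. -/
def IsSingularCocycle {Y : Type*} [TopologicalSpace Y] {V : ℤ → Type*} [∀ q, AddCommGroup (V q)]
    {n : ℤ} (κ : SingularCochain Y V n) : Prop :=
  ∀ (p : ℕ) (q : ℤ) (hpq : (p : ℤ) + q = n + 1) (σ : SingularSimplex Y p),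
    coboundary (singularFace Y) κ p q hpq σ = 0

/-! ### Cartesian coordinates on the standard simplex -/

/-- The simplex `{t ∈ ℝᵖ | t_i ≥ 0, ∑ t_i ≤ 1}` with vertices `0, e_1, …, e_p`. -/
def corner (p : ℕ) : Set (Fin p → ℝ) :=
  {t | (∀ i, 0 ≤ t i) ∧ ∑ i, t i ≤ 1}

/-- Barycentric coordinates `(1 - ∑ t_i, t_1, …, t_p)`. -/
def baryVec {p : ℕ} (t : Fin p → ℝ) : Fin (p + 1) → ℝ :=
  Fin.cons (1 - ∑ i, t i) t

theorem baryVec_mem {p : ℕ} {t : Fin p → ℝ} (ht : t ∈ corner p) :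
    baryVec t ∈ stdSimplex ℝ (Fin (p + 1)) := by
  refine ⟨fun i => ?_, ?_⟩
  · refine Fin.cases ?_ (fun j => ?_) i
    · simpa [baryVec] using ht.2
    · simpa [baryVec] using ht.1 j
  · simp [baryVec, Fin.sum_univ_succ]

open Classical in
/-- The affine bijection from `corner p` onto the standard simplex that preserves the order of the
vertices (with the value `vertex 0` outside `corner p`). -/
def bary (p : ℕ) (t : Fin p → ℝ) : stdSimplex ℝ (Fin (p + 1)) :=
  if ht : t ∈ corner p then ⟨baryVec t, baryVec_mem ht⟩ else stdSimplex.vertex 0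

theorem bary_of_mem {p : ℕ} {t : Fin p → ℝ} (ht : t ∈ corner p) :
    bary p t = ⟨baryVec t, baryVec_mem ht⟩ := dif_pos ht

/-- The face inclusion in Cartesian coordinates. -/
def cornerFace (p : ℕ) (i : Fin (p + 2)) (t : Fin p → ℝ) : Fin (p + 1) → ℝ :=
  fun j => FunOnFinite.linearMap ℝ ℝ i.succAbove (baryVec t) j.succ

theorem cornerFace_mem {p : ℕ} (i : Fin (p + 2)) {t : Fin p → ℝ} (ht : t ∈ corner p) :
    cornerFace p i t ∈ corner (p + 1) := by
  have h := stdSimplex.image_linearMap (S := ℝ) i.succAbove ⟨_, baryVec_mem ht, rfl⟩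
  refine ⟨fun j => h.1 _, ?_⟩
  have h2 := h.2
  rw [Fin.sum_univ_succ] at h2
  have h0 := h.1 0
  simp only [cornerFace]
  linarith

theorem faceIncl_bary {p : ℕ} (i : Fin (p + 2)) {t : Fin p → ℝ} (ht : t ∈ corner p) :
    faceIncl p i (bary p t) = bary (p + 1) (cornerFace p i t) := by
  have h := stdSimplex.image_linearMap (S := ℝ) i.succAbove ⟨_, baryVec_mem ht, rfl⟩
  rw [bary_of_mem ht, bary_of_mem (cornerFace_mem i ht)]
  apply Subtype.ext
  change FunOnFinite.linearMap ℝ ℝ i.succAbove (baryVec t) = baryVec (cornerFace p i t)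
  funext j
  refine Fin.cases ?_ (fun j => ?_) j
  · have h2 := h.2
    rw [Fin.sum_univ_succ] at h2
    simp only [baryVec, Fin.cons_zero, cornerFace]
    simp only [baryVec] at h2
    linarith
  · simp [baryVec, cornerFace]

theorem contDiff_cornerFace (p : ℕ) (i : Fin (p + 2)) : ContDiff ℝ ∞ (cornerFace p i) := by
  have h1 : ContDiff ℝ ∞ (baryVec : (Fin p → ℝ) → Fin (p + 1) → ℝ) := by
    rw [contDiff_pi]
    intro j
    refine Fin.cases ?_ (fun j => ?_) j
    · simp only [baryVec, Fin.cons_zero]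
      fun_prop
    · simp only [baryVec, Fin.cons_succ]
      fun_prop
  rw [contDiff_pi]
  intro j
  have h2 : ContDiff ℝ ∞ (fun v => FunOnFinite.linearMap ℝ ℝ i.succAbove v j.succ) :=
    (LinearMap.toContinuousLinearMap
      (LinearMap.proj j.succ ∘ₗ FunOnFinite.linearMap ℝ ℝ i.succAbove)).contDiff
  exact h2.comp h1

/-! ### Differential forms with values in a real vector space -/

theorem continuous_multilinear {E : Type*} [NormedAddCommGroup E] [NormedSpace ℝ E]
    [FiniteDimensional ℝ E] {p : ℕ} (f : MultilinearMap ℝ (fun _ : Fin p => E) ℝ) :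
    Continuous f := by
  classical
  let b := Module.finBasis ℝ E
  have h : ∀ v : Fin p → E, f v = ∑ r : (∀ _ : Fin p, Fin (Module.finrank ℝ E)),
      (∏ i, b.coord (r i) (v i)) * f (fun i => b (r i)) := by
    intro v
    conv_lhs => rw [show v = fun i => ∑ j, b.coord j (v i) • b j from
      funext fun i => (b.sum_repr (v i)).symm]
    rw [f.map_sum]
    exact Finset.sum_congr rfl fun r _ => by rw [f.map_smul_univ, smul_eq_mul]
  rw [show (f : (Fin p → E) → ℝ) = _ from funext h]
  refine continuous_finsetSum _ fun r _ => (continuous_finsetProd _ fun i _ => ?_).mul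
    continuous_const
  exact (LinearMap.continuous_of_finiteDimensional (b.coord (r i))).comp (continuous_apply i)

section Forms

variable {E : Type*} [NormedAddCommGroup E] [NormedSpace ℝ E]
  {H : Type*} [TopologicalSpace H] (I : ModelWithCorners ℝ E H)
  {M : Type*} [TopologicalSpace M] [ChartedSpace H M]

/-- The expression of a real `p`-form in the preferred chart at `x₀` (its pull-back to the model
space under the inverse of the chart). -/
def formInChart {p : ℕ} (η : ∀ x : M, TangentSpace I x [⋀^Fin p]→L[ℝ] ℝ) (x₀ : M) :
    E → E [⋀^Fin p]→L[ℝ] ℝ :=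
  fun y => (η ((extChartAt I x₀).symm y)).compContinuousLinearMap
    (mfderivWithin 𝓘(ℝ, E) I (extChartAt I x₀).symm (range I) y)

/-- A real form is smooth if all of its chart expressions are. -/
def IsSmoothForm {p : ℕ} (η : ∀ x : M, TangentSpace I x [⋀^Fin p]→L[ℝ] ℝ) : Prop :=
  ∀ x₀ : M, ContDiffOn ℝ ∞ (formInChart I η x₀) (extChartAt I x₀).target

/-- A real form is closed if the exterior derivatives of all its chart expressions vanish. -/
def IsClosedForm {p : ℕ} (η : ∀ x : M, TangentSpace I x [⋀^Fin p]→L[ℝ] ℝ) : Prop :=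
  ∀ x₀ : M, ∀ y ∈ (extChartAt I x₀).target,
    extDerivWithin (formInChart I η x₀) (range I) y = 0

variable [FiniteDimensional ℝ E]

/-- The real component `ℓ ∘ η` of an alternating map with values in a real vector space. -/
def formComponent {p : ℕ} {W : Type*} [AddCommGroup W] [Module ℝ W] {x : M}
    (η : TangentSpace I x [⋀^Fin p]→ₗ[ℝ] W) (ℓ : W →ₗ[ℝ] ℝ) : TangentSpace I x [⋀^Fin p]→L[ℝ] ℝ :=
  { ℓ.compAlternatingMap η with
    cont := by
      exact continuous_multilinear (E := E) (ℓ.compAlternatingMap η).toMultilinearMap }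

variable (M) in
/-- Closed smooth `p`-forms on `M` with values in the real vector space `W`. No topology on `W` is
needed: locally such a form takes its values in a finite-dimensional subspace of `W`, and there
smoothness and closedness are tested on the components. If `W` is finite-dimensional these are all
the closed smooth forms with values in `W`. -/
structure ClosedForm (p : ℕ) (W : Type*) [AddCommGroup W] [Module ℝ W] where
  /-- The value of the form at a point. -/
  toFun : ∀ x : M, TangentSpace I x [⋀^Fin p]→ₗ[ℝ] W
  locally_finite : ∀ x₀ : M, ∃ U : Set M, IsOpen U ∧ x₀ ∈ U ∧ ∃ F : Submodule ℝ W,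
    FiniteDimensional ℝ F ∧ ∀ x ∈ U, ∀ v, toFun x v ∈ F
  smooth : ∀ ℓ : W →ₗ[ℝ] ℝ, IsSmoothForm I (fun x => formComponent I (toFun x) ℓ)
  closed : ∀ ℓ : W →ₗ[ℝ] ℝ, IsClosedForm I (fun x => formComponent I (toFun x) ℓ)

open Classical in
/-- The integral over `s` of a vector-valued function: the vector `w` (unique, if it exists) with
`ℓ w = ∫ ℓ ∘ g` for all linear functionals `ℓ`. It exists if `g` is integrable with values in a
finite-dimensional subspace. -/
def vectorIntegral {p : ℕ} {W : Type*} [AddCommGroup W] [Module ℝ W]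
    (s : Set (Fin p → ℝ)) (g : (Fin p → ℝ) → W) : W :=
  if h : ∃ w : W, ∀ ℓ : W →ₗ[ℝ] ℝ, ℓ w = ∫ t in s, ℓ (g t) then h.choose else 0

/-- The integral of a form on `M` over a simplex of `M`, that is, the integral over `corner p` of
`η(∂σ/∂t_1, …, ∂σ/∂t_p) dt_1 ⋯ dt_p`. -/
def integralForm {p : ℕ} {W : Type*} [AddCommGroup W] [Module ℝ W]
    (η : ClosedForm I M p W) (σ : stdSimplex ℝ (Fin (p + 1)) → M) : W :=
  vectorIntegral (corner p) fun t => η.toFun (σ (bary p t)) fun i =>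
    mfderivWithin 𝓘(ℝ, Fin p → ℝ) I (fun t => σ (bary p t)) (corner p) t
      (Pi.single i 1 : Fin p → ℝ)

end Forms

/-! ### Manifolds, neat submanifolds, manifolds with cylinders -/

/-- The model of manifolds without boundary, or of manifolds with boundary: the range of the model
is the whole vector space or a closed half-space. -/
def IsBoundaryModel {E : Type*} [NormedAddCommGroup E] [NormedSpace ℝ E]
    {H : Type*} [TopologicalSpace H] (I : ModelWithCorners ℝ E H) : Prop :=
  range I = univ ∨ ∃ ℓ : E →L[ℝ] ℝ, ℓ ≠ 0 ∧ range I = {y | 0 ≤ ℓ y}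

/-- `Cyl(X, A) = X × {0} ∪ A × [0, 1]`; the coordinate of the new interval comes last. -/
def cyl {M : Type*} {k : ℕ} (X A : Set (M × (Fin k → ℝ))) : Set (M × (Fin (k + 1) → ℝ)) :=
  {x | ((x.1, Fin.init x.2) ∈ X ∧ x.2 (Fin.last k) = 0) ∨
    ((x.1, Fin.init x.2) ∈ A ∧ x.2 (Fin.last k) ∈ Icc (0 : ℝ) 1)}

/-- `X × [0, 1]`. -/
def prodI {M : Type*} {k : ℕ} (X : Set (M × (Fin k → ℝ))) : Set (M × (Fin (k + 1) → ℝ)) :=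
  {x | (x.1, Fin.init x.2) ∈ X ∧ x.2 (Fin.last k) ∈ Icc (0 : ℝ) 1}

/-- `X × {1}`. -/
def top {M : Type*} {k : ℕ} (X : Set (M × (Fin k → ℝ))) : Set (M × (Fin (k + 1) → ℝ)) :=
  {x | (x.1, Fin.init x.2) ∈ X ∧ x.2 (Fin.last k) = 1}

theorem cyl_subset_prodI {M : Type*} {k : ℕ} {X A : Set (M × (Fin k → ℝ))} (hAX : A ⊆ X) :
    cyl X A ⊆ prodI X := by
  rintro x (⟨hx, h0⟩ | ⟨hx, h1⟩)
  · exact ⟨hx, by simp [h0]⟩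
  · exact ⟨hAX hx, h1⟩

section Spaces

variable {E : Type*} [NormedAddCommGroup E] [NormedSpace ℝ E]
  {H : Type*} [TopologicalSpace H] (I : ModelWithCorners ℝ E H)
  {M : Type*} [TopologicalSpace M] [ChartedSpace H M]

/-- Closed neat submanifolds: around each of its points `x`, in a suitable chart, `N` is the
affine subspace through `x` with direction `L`, which at a point of the boundary of `M` is
transverse to the boundary. If `M` has no boundary these are the closed embedded submanifolds
without boundary. -/
def IsNeatSubmanifold (N : Set M) : Prop :=
  IsClosed N ∧ ∀ x ∈ N, ∃ φ ∈ IsManifold.maximalAtlas I ∞ M, x ∈ φ.source ∧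
    ∃ L : Submodule ℝ E,
      (∀ y ∈ φ.source, y ∈ N ↔ φ.extend I y - φ.extend I x ∈ L) ∧
      (φ.extend I x ∈ frontier (range I) →
        ∃ v ∈ L, φ.extend I x + v ∈ interior (range I))

/-- The manifolds with cylinders over `M`, as subspaces of `M × [0, 1]ᵏ`: they are obtained from
neat submanifolds of `M` (in particular `M` itself and `∅`) by iterating the construction of the
cylinder `Cyl(X, A)` of a pair. The last clause also admits `Cyl(X, A) ∪ D × {1}`, where `D ⊇ A` is
glued to the other end of the cylinder `A × [0, 1]`; so `X ∪ A × {1} ⊆ Cyl(X, A)` and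
`Cyl(X, A) ∪ X × {1} ⊆ X × [0, 1]` are manifolds with cylinders. -/
inductive IsManifoldWithCylinders : ∀ k : ℕ, Set (M × (Fin k → ℝ)) → Prop
  | base (N : Set M) (hN : IsNeatSubmanifold I N) :
      IsManifoldWithCylinders 0 {x | x.1 ∈ N}
  | cyl (k : ℕ) (X A : Set (M × (Fin k → ℝ))) (hX : IsManifoldWithCylinders k X)
      (hA : IsManifoldWithCylinders k A) (hAX : A ⊆ X) :
      IsManifoldWithCylinders (k + 1) (cyl X A)
  | cylTop (k : ℕ) (X A D : Set (M × (Fin k → ℝ))) (hX : IsManifoldWithCylinders k X)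
      (hA : IsManifoldWithCylinders k A) (hD : IsManifoldWithCylinders k D)
      (hAX : A ⊆ X) (hAD : A ⊆ D) :
      IsManifoldWithCylinders (k + 1) (cyl X A ∪ top D)

/-! ### Smooth singular cochains and differential functions -/

/-- Smooth singular `p`-simplices of a subset `S` of `M × ℝᵏ`. -/
@[ext]
structure SmoothSimplex {k : ℕ} (S : Set (M × (Fin k → ℝ))) (p : ℕ) where
  /-- The underlying singular simplex. -/
  toMap : SingularSimplex S p
  smooth_fst : ContMDiffOn 𝓘(ℝ, Fin p → ℝ) I ∞ (fun t => (toMap (bary p t)).1.1) (corner p)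
  smooth_snd : ContDiffOn ℝ ∞ (fun t => (toMap (bary p t)).1.2) (corner p)

variable {k : ℕ}

/-- The faces of a smooth simplex. -/
def smoothFace (S : Set (M × (Fin k → ℝ))) (p : ℕ) (i : Fin (p + 2))
    (σ : SmoothSimplex I S (p + 1)) : SmoothSimplex I S p where
  toMap := singularFace S p i σ.toMap
  smooth_fst := by
    refine (σ.smooth_fst.comp (contDiff_cornerFace p i).contMDiff.contMDiffOn
      (fun t ht => cornerFace_mem i ht)).congr fun t ht => ?_
    change (σ.toMap (faceIncl p i (bary p t))).1.1 = _
    rw [faceIncl_bary i ht]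
    rfl
  smooth_snd := by
    refine (σ.smooth_snd.comp (contDiff_cornerFace p i).contDiffOn
      (fun t ht => cornerFace_mem i ht)).congr fun t ht => ?_
    change (σ.toMap (faceIncl p i (bary p t))).1.2 = _
    rw [faceIncl_bary i ht]
    rfl

/-- A smooth simplex of `S`, seen in a larger subset. -/
def SmoothSimplex.incl {S T : Set (M × (Fin k → ℝ))} (hST : S ⊆ T) {p : ℕ}
    (σ : SmoothSimplex I S p) : SmoothSimplex I T p where
  toMap := (ContinuousMap.inclusion hST).comp σ.toMap
  smooth_fst := σ.smooth_fst
  smooth_snd := σ.smooth_snd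

/-- `Cⁿ(S; V)`: smooth singular cochains of total degree `n`. -/
abbrev SmoothCochain (S : Set (M × (Fin k → ℝ))) (V : ℤ → Type*) (n : ℤ) : Type _ :=
  Cochain (SmoothSimplex I S) V n

variable [FiniteDimensional ℝ E]

variable (M) in
/-- `Ωⁿ_cl(M; V)`: closed forms of total degree `n` with values in the graded vector space `V`. -/
abbrev ClosedGradedForm (V : ℤ → Type*) [∀ q, AddCommGroup (V q)] [∀ q, Module ℝ (V q)]
    (n : ℤ) : Type _ :=
  ∀ (p : ℕ) (q : ℤ), (p : ℤ) + q = n → ClosedForm I M p (V q)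

/-- `χ(π^* η)`, for `π : S → M` the projection: the smooth singular cochain which integrates the
pull-back of `η` over the smooth simplices of `S`. -/
def chi {V : ℤ → Type*} [∀ q, AddCommGroup (V q)] [∀ q, Module ℝ (V q)] {n : ℤ}
    (S : Set (M × (Fin k → ℝ))) (η : ClosedGradedForm I M V n) : SmoothCochain I S V n :=
  fun p q hpq σ => integralForm I (η p q hpq) fun x => (σ.toMap x).1.1

/-- `f^* κ`, as a smooth singular cochain. -/
def pullbackCochain {Y : Type*} [TopologicalSpace Y] {V : ℤ → Type*} {n : ℤ}
    {S : Set (M × (Fin k → ℝ))} (f : C(S, Y)) (κ : SingularCochain Y V n) :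
    SmoothCochain I S V n :=
  fun p q hpq σ => κ p q hpq (f.comp σ.toMap)

/-- Differential functions `(f, h, π^* η) : S → (Y, κ)`, where the curvature is the pull-back of
a closed form `η` on the base `M`. For `S = M` these are the differential functions
`(f, h, η) : M → (Y, κ)`, and for `S = X × [0, 1]` the homotopies of differential functions
on `X`. -/
structure DifferentialFunction {Y : Type*} [TopologicalSpace Y] {V : ℤ → Type*}
    [∀ q, AddCommGroup (V q)] [∀ q, Module ℝ (V q)] {n : ℤ}
    (S : Set (M × (Fin k → ℝ))) (κ : SingularCochain Y V n) where
  /-- The continuous map. -/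
  f : C(S, Y)
  /-- The cochain. -/
  h : SmoothCochain I S V (n - 1)
  /-- The form on the base whose pull-back is the curvature. -/
  curv : ClosedGradedForm I M V n
  coboundary_eq : ∀ (p : ℕ) (q : ℤ) (hpq : (p : ℤ) + q = n) (σ : SmoothSimplex I S p),
    coboundary (smoothFace I S) h p q (by omega) σ =
      chi I S curv p q hpq σ - pullbackCochain I f κ p q hpq σ

end Spaces

end DiffHEP

end

namespace DiffHEP

open Filter Topology

/-! ### Neighbourhood extensors -/

section Extensor

variable {Z : Type*} {P : Type*} [TopologicalSpace P]

/-- The subspace `S` is a neighbourhood extensor for `Z`: a map to `S` from a closed subset of `Z`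
extends to an open neighbourhood of that subset. -/
def IsNbhdExtensor (Z : Type*) [TopologicalSpace Z] (S : Set P) : Prop :=
  ∀ (C : Set Z) (f : Z → P), IsClosed C → ContinuousOn f C → MapsTo f C S →
    ∃ (U : Set Z) (g : Z → P), IsOpen U ∧ C ⊆ U ∧ ContinuousOn g U ∧ MapsTo g U S ∧ EqOn g f C

theorem exists_continuous_eqOn.{u, v} {Z : Type u} [TopologicalSpace Z] [NormalSpace Z]
    {W : Type v} [TopologicalSpace W] [TietzeExtension.{u, v} W] {C : Set Z}
    (hC : IsClosed C) {f : Z → W}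
    (hf : ContinuousOn f C) : ∃ g : Z → W, Continuous g ∧ EqOn g f C := by
  obtain ⟨g, hg⟩ := ContinuousMap.exists_restrict_eq hC ⟨C.domRestrict f, hf.domRestrict⟩
  exact ⟨g, g.continuous, fun x hx => congrArg (fun F => F ⟨x, hx⟩) hg⟩

/-- At a point off a closed `K`, continuity within `U ∩ K` is vacuous, so the two closed pieces can
be glued although `U` itself need not be closed. -/
theorem continuousOn_of_inter_isClosed [TopologicalSpace Z] {g : Z → P} {U Z₁ Z₂ : Set Z}
    (h₁ : IsClosed Z₁) (h₂ : IsClosed Z₂) (hZ : U ⊆ Z₁ ∪ Z₂) (hg₁ : ContinuousOn g (U ∩ Z₁))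
    (hg₂ : ContinuousOn g (U ∩ Z₂)) : ContinuousOn g U := by
  have key : ∀ {K : Set Z}, IsClosed K → ContinuousOn g (U ∩ K) → ∀ z ∈ U,
      ContinuousWithinAt g (U ∩ K) z := by
    intro K hK hg z hz
    by_cases hzK : z ∈ K
    · exact hg z ⟨hz, hzK⟩
    · exact continuousWithinAt_of_notMem_closure fun h =>
        hzK (hK.closure_subset_iff.2 inter_subset_right h)
  intro z hz
  refine ((key h₁ hg₁ z hz).union (key h₂ hg₂ z hz)).mono fun x hx => ?_
  rcases hZ hx with h | h
  · exact Or.inl ⟨hx, h⟩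
  · exact Or.inr ⟨hx, h⟩

theorem IsNbhdExtensor.inter_isOpen [TopologicalSpace Z] {S O : Set P}
    (hS : IsNbhdExtensor Z S) (hO : IsOpen O) : IsNbhdExtensor Z (S ∩ O) := by
  intro C f hC hf hfS
  obtain ⟨U, g, hU, hCU, hg, hgS, hgf⟩ := hS C f hC hf fun z hz => (hfS hz).1
  refine ⟨U ∩ g ⁻¹' O, g, hg.isOpen_inter_preimage hU hO, fun z hz => ⟨hCU hz, ?_⟩,
    hg.mono inter_subset_left, fun z hz => ⟨hgS hz.1, hz.2⟩, hgf⟩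
  rw [mem_preimage, hgf hz]
  exact (hfS hz).2

theorem IsNbhdExtensor.empty [TopologicalSpace Z] : IsNbhdExtensor Z (∅ : Set P) := by
  intro C f _ _ hf
  have hC : C = ∅ := eq_empty_of_forall_notMem fun z hz => hf hz
  exact ⟨∅, f, isOpen_empty, hC.subset, continuousOn_empty f, mapsTo_empty f _,
    by rw [hC]; exact eqOn_empty _ _⟩

/-- Tietze extends the real coordinate. The extra coordinate is the room used in
`IsNbhdExtensor.of_monotone_cover` to make pieces disjoint. -/
theorem IsNbhdExtensor.prod_univ [TopologicalSpace Z] [NormalSpace Z] {S : Set P}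
    (hS : IsNbhdExtensor Z S) : IsNbhdExtensor Z {x : P × ℝ | x.1 ∈ S} := by
  intro C f hC hf hfS
  obtain ⟨U, g, hU, hCU, hg, hgS, hgf⟩ := hS C (fun z => (f z).1) hC
    (continuous_fst.comp_continuousOn hf) hfS
  obtain ⟨l, hl, hlf⟩ := exists_continuous_eqOn (W := ℝ) hC (continuous_snd.comp_continuousOn hf)
  exact ⟨U, fun z => (g z, l z), hU, hCU, hg.prodMk hl.continuousOn, hgS,
    fun z hz => Prod.ext (hgf hz) (hlf hz)⟩

/-- Extensions over the two parts of a closed decomposition of the source can be glued. -/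
theorem exists_extension_of_decomposition [TopologicalSpace Z] [NormalSpace Z]
    {S₀ S₁ S₂ : Set P} (h₀ : IsNbhdExtensor Z S₀) (h₁ : IsNbhdExtensor Z S₁)
    (h₂ : IsNbhdExtensor Z S₂) (h₀₁ : S₀ ⊆ S₁) (h₀₂ : S₀ ⊆ S₂) {C Z₁ Z₂ : Set Z}
    (hC : IsClosed C) (hZ₁ : IsClosed Z₁) (hZ₂ : IsClosed Z₂) (hZ : Z₁ ∪ Z₂ = univ) {f : Z → P}
    (hf : ContinuousOn f C) (hf₀ : MapsTo f (C ∩ (Z₁ ∩ Z₂)) S₀) (hf₁ : MapsTo f (C ∩ Z₁) S₁)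
    (hf₂ : MapsTo f (C ∩ Z₂) S₂) :
    ∃ (U : Set Z) (g : Z → P), IsOpen U ∧ C ⊆ U ∧ ContinuousOn g U ∧ MapsTo g U (S₁ ∪ S₂) ∧
      EqOn g f C := by
  classical
  have hZ₀ : IsClosed (Z₁ ∩ Z₂) := hZ₁.inter hZ₂
  -- Extend over the overlap `Z₁ ∩ Z₂` first, with values in `S₀`. Both later extensions are then
  -- prescribed on a closed neighbourhood `W` of `C ∩ (Z₁ ∩ Z₂)` in the overlap.
  obtain ⟨O, g₀, hO, hCO, hg₀, hg₀S, hg₀f⟩ := h₀ (C ∩ (Z₁ ∩ Z₂)) f (hC.inter hZ₀)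
    (hf.mono inter_subset_left) hf₀
  obtain ⟨O', hO', hCO', hO'O⟩ := normal_exists_closure_subset (hC.inter hZ₀) hO hCO
  set W := closure O' ∩ (Z₁ ∩ Z₂) with hW
  have hWc : IsClosed W := isClosed_closure.inter hZ₀
  have hg₀W : ContinuousOn g₀ W := hg₀.mono (inter_subset_left.trans hO'O)
  set h : Z → P := W.piecewise g₀ f with hh
  have hhW : EqOn h g₀ W := fun z hz => piecewise_eq_of_mem _ _ _ hz
  have hhC : EqOn h f C := by
    intro z hz
    by_cases hzW : z ∈ W
    · rw [hhW hzW, hg₀f ⟨hz, hzW.2⟩]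
    · exact piecewise_eq_of_notMem _ _ _ hzW
  have hhcont : ∀ {K : Set Z}, IsClosed K → ContinuousOn h (C ∩ K ∪ W) := fun {K} hK =>
    ((hf.mono inter_subset_left).congr (hhC.mono inter_subset_left)).union_of_isClosed
      (hg₀W.congr hhW) (hC.inter hK) hWc
  have hext : ∀ {S : Set P} {K : Set Z}, IsNbhdExtensor Z S → S₀ ⊆ S → IsClosed K →
      MapsTo f (C ∩ K) S → ∃ (U : Set Z) (g : Z → P), IsOpen U ∧ C ∩ K ⊆ U ∧
        ContinuousOn g U ∧ MapsTo g U S ∧ EqOn g f (C ∩ K) ∧ EqOn g g₀ W ∧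
        (∀ z ∈ U, z ∈ Z₁ ∩ Z₂ → z ∈ W) := by
    intro S K hS hS₀ hK hfK
    obtain ⟨U, g, hU, hCU, hg, hgS, hgh⟩ := hS (C ∩ K ∪ W) h ((hC.inter hK).union hWc)
      (hhcont hK) (by
        rintro z (hz | hz)
        · rw [hhC hz.1]; exact hfK hz
        · rw [hhW hz]; exact hS₀ (hg₀S (hO'O hz.1)))
    -- Cutting down by `O' ∪ (Z₁ ∩ Z₂)ᶜ` confines the domain within the overlap to `W`, where the
    -- extension is `g₀`; this is what makes the two extensions agree.
    refine ⟨U ∩ (O' ∪ (Z₁ ∩ Z₂)ᶜ), g, hU.inter (hO'.union hZ₀.isOpen_compl), ?_,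
      hg.mono inter_subset_left, hgS.mono_left inter_subset_left,
      fun z hz => (hgh (Or.inl hz)).trans (hhC hz.1), fun z hz => (hgh (Or.inr hz)).trans (hhW hz),
      ?_⟩
    · intro z hz
      refine ⟨hCU (Or.inl hz), ?_⟩
      by_cases hz₀ : z ∈ Z₁ ∩ Z₂
      · exact Or.inl (hCO' ⟨hz.1, hz₀⟩)
      · exact Or.inr hz₀
    · rintro z ⟨-, hz | hz⟩ hz₀
      · exact ⟨subset_closure hz, hz₀⟩
      · exact absurd hz₀ hz
  obtain ⟨U₁, g₁, hU₁, hCU₁, hg₁, hg₁S, hg₁f, hg₁W, hU₁W⟩ := hext h₁ h₀₁ hZ₁ hf₁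
  obtain ⟨U₂, g₂, hU₂, hCU₂, hg₂, hg₂S, hg₂f, hg₂W, hU₂W⟩ := hext h₂ h₀₂ hZ₂ hf₂
  set U := (Z₁ᶜ ∪ U₁) ∩ (Z₂ᶜ ∪ U₂) with hU
  have hUZ₁ : U ∩ Z₁ ⊆ U₁ := fun z hz => hz.1.1.resolve_left fun h => h hz.2
  have hUZ₂ : U ∩ Z₂ ⊆ U₂ := fun z hz => hz.1.2.resolve_left fun h => h hz.2
  set g : Z → P := Z₁.piecewise g₁ g₂ with hg
  have e₁ : EqOn g g₁ Z₁ := fun z hz => piecewise_eq_of_mem _ _ _ hz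
  have e₂ : EqOn g g₂ (U ∩ Z₂) := by
    intro z hz
    by_cases hz₁ : z ∈ Z₁
    · have hzW : z ∈ W := hU₂W z (hUZ₂ hz) ⟨hz₁, hz.2⟩
      rw [e₁ hz₁, hg₁W hzW, hg₂W hzW]
    · exact piecewise_eq_of_notMem _ _ _ hz₁
  have hZz : ∀ z, z ∈ Z₁ ∨ z ∈ Z₂ := fun z => hZ.symm.subset (mem_univ z)
  have hCU : C ⊆ U := by
    intro z hz
    constructor
    · by_cases hz₁ : z ∈ Z₁
      · exact Or.inr (hCU₁ ⟨hz, hz₁⟩)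
      · exact Or.inl hz₁
    · by_cases hz₂ : z ∈ Z₂
      · exact Or.inr (hCU₂ ⟨hz, hz₂⟩)
      · exact Or.inl hz₂
  refine ⟨U, g, (hZ₁.isOpen_compl.union hU₁).inter (hZ₂.isOpen_compl.union hU₂), hCU, ?_, ?_, ?_⟩
  · refine continuousOn_of_inter_isClosed hZ₁ hZ₂ (fun z _ => hZz z) ?_ ?_
    · exact (hg₁.mono hUZ₁).congr (e₁.mono inter_subset_right)
    · exact (hg₂.mono hUZ₂).congr e₂
  · intro z hz
    rcases hZz z with hz' | hz'
    · rw [e₁ hz']; exact Or.inl (hg₁S (hUZ₁ ⟨hz, hz'⟩))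
    · rw [e₂ ⟨hz, hz'⟩]; exact Or.inr (hg₂S (hUZ₂ ⟨hz, hz'⟩))
  · intro z hz
    rcases hZz z with hz' | hz'
    · rw [e₁ hz', hg₁f ⟨hz, hz'⟩]
    · rw [e₂ ⟨hCU hz, hz'⟩, hg₂f ⟨hz, hz'⟩]

/-- Split the source according to which of the closed sets `C ∩ f ⁻¹' S₁` and `C ∩ f ⁻¹' S₂` is
nearer. On `C` one of the two distances is zero, so the nearer set contains the point. Extended
distances also cover the case that one set is empty. -/
theorem IsNbhdExtensor.union_isClosed [PseudoEMetricSpace Z] {S₁ S₂ : Set P}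
    (h₁ : IsNbhdExtensor Z S₁) (h₂ : IsNbhdExtensor Z S₂) (h₀ : IsNbhdExtensor Z (S₁ ∩ S₂))
    (hS₁ : IsClosed S₁) (hS₂ : IsClosed S₂) : IsNbhdExtensor Z (S₁ ∪ S₂) := by
  intro C f hC hf hfS
  have hC₁ : IsClosed (C ∩ f ⁻¹' S₁) := hf.preimage_isClosed_of_isClosed hC hS₁
  have hC₂ : IsClosed (C ∩ f ⁻¹' S₂) := hf.preimage_isClosed_of_isClosed hC hS₂
  set d₁ : Z → ENNReal := fun z => Metric.infEDist z (C ∩ f ⁻¹' S₁)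
  set d₂ : Z → ENNReal := fun z => Metric.infEDist z (C ∩ f ⁻¹' S₂)
  have hd₁ : Continuous d₁ := Metric.continuous_infEDist
  have hd₂ : Continuous d₂ := Metric.continuous_infEDist
  have m₁ : MapsTo f (C ∩ {z | d₁ z ≤ d₂ z}) S₁ := by
    rintro z ⟨hz, hd⟩
    rcases hfS hz with h | h
    · exact h
    · have : d₂ z = 0 := Metric.infEDist_zero_of_mem ⟨hz, h⟩
      rw [mem_ofPred_eq, this, nonpos_iff_eq_zero] at hd
      exact ((Metric.mem_iff_infEDist_zero_of_closed hC₁).2 hd).2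
  have m₂ : MapsTo f (C ∩ {z | d₂ z ≤ d₁ z}) S₂ := by
    rintro z ⟨hz, hd⟩
    rcases hfS hz with h | h
    · have : d₁ z = 0 := Metric.infEDist_zero_of_mem ⟨hz, h⟩
      rw [mem_ofPred_eq, this, nonpos_iff_eq_zero] at hd
      exact ((Metric.mem_iff_infEDist_zero_of_closed hC₂).2 hd).2
    · exact h
  exact exists_extension_of_decomposition h₀ h₁ h₂ inter_subset_left inter_subset_right hC
    (isClosed_le hd₁ hd₂) (isClosed_le hd₂ hd₁)
    (eq_univ_of_forall fun z => le_total (d₁ z) (d₂ z)) hf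
    (fun z hz => ⟨m₁ ⟨hz.1, hz.2.1⟩, m₂ ⟨hz.1, hz.2.2⟩⟩) m₁ m₂

/-- The points of `C` sent outside `O₁` and those sent outside `O₂` form disjoint closed sets; the
level `1 / 2` of a Urysohn function between them cuts the source into two closed parts. -/
theorem IsNbhdExtensor.union_inter_isOpen [TopologicalSpace Z] [NormalSpace Z] {S O₁ O₂ : Set P}
    (h₁ : IsNbhdExtensor Z (S ∩ O₁)) (h₂ : IsNbhdExtensor Z (S ∩ O₂))
    (hO₁ : IsOpen O₁) (hO₂ : IsOpen O₂) : IsNbhdExtensor Z (S ∩ (O₁ ∪ O₂)) := by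
  intro C f hC hf hfS
  obtain ⟨A, hA, hAC⟩ := continuousOn_iff_isClosed.1 hf O₁ᶜ hO₁.isClosed_compl
  obtain ⟨B, hB, hBC⟩ := continuousOn_iff_isClosed.1 hf O₂ᶜ hO₂.isClosed_compl
  have hd : Disjoint (A ∩ C) (B ∩ C) := by
    rw [← hAC, ← hBC, Set.disjoint_left]
    rintro z ⟨hz₁, hz⟩ ⟨hz₂, -⟩
    exact (hfS hz).2.elim hz₁ hz₂
  obtain ⟨u, hu0, hu1, -⟩ := exists_continuous_zero_one_of_isClosed (hA.inter hC) (hB.inter hC) hd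
  have m₁ : MapsTo f (C ∩ {z | (1 / 2 : ℝ) ≤ u z}) (S ∩ O₁) := by
    rintro z ⟨hz, hd⟩
    refine ⟨(hfS hz).1, by_contra fun h => ?_⟩
    have : z ∈ A ∩ C := hAC.subset ⟨h, hz⟩
    have := hu0 this
    norm_num [this] at hd
  have m₂ : MapsTo f (C ∩ {z | u z ≤ (1 / 2 : ℝ)}) (S ∩ O₂) := by
    rintro z ⟨hz, hd⟩
    refine ⟨(hfS hz).1, by_contra fun h => ?_⟩
    have : z ∈ B ∩ C := hBC.subset ⟨h, hz⟩
    have := hu1 this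
    norm_num [this] at hd
  have := exists_extension_of_decomposition (h₁.inter_isOpen hO₂) h₁ h₂ inter_subset_left
    (fun x hx => ⟨hx.1.1, hx.2⟩) hC (isClosed_le continuous_const u.continuous)
    (isClosed_le u.continuous continuous_const)
    (eq_univ_of_forall fun z => le_total (1 / 2 : ℝ) (u z)) hf
    (fun z hz => ⟨m₁ ⟨hz.1, hz.2.1⟩, (m₂ ⟨hz.1, hz.2.2⟩).2⟩) m₁ m₂
  rwa [inter_union_distrib_left]

/-- The disjoint open sets `G i` cut `C` into pieces that are closed and relatively open. The points
strictly nearer to one piece than to the rest of `C` form disjoint open neighbourhoods of the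
pieces, so the separate extensions never compete. -/
theorem IsNbhdExtensor.iUnion_disjoint [PseudoEMetricSpace Z] {ι : Type*} {S G : ι → Set P}
    (hS : ∀ i, IsNbhdExtensor Z (S i)) (hG : ∀ i, IsOpen (G i)) (hSG : ∀ i, S i ⊆ G i)
    (hd : Pairwise (Function.onFun Disjoint G)) : IsNbhdExtensor Z (⋃ i, S i) := by
  classical
  intro C f hC hf hfS
  have hSi : ∀ z ∈ C, ∀ i, f z ∈ G i → f z ∈ S i := by
    intro z hz i hi
    obtain ⟨j, hj⟩ := mem_iUnion.1 (hfS hz)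
    by_cases hij : i = j
    · rwa [hij]
    · exact absurd (hSG j hj) (Set.disjoint_left.1 (hd hij) hi)
  have hCi : ∀ i, IsClosed (C ∩ f ⁻¹' G i) := by
    intro i
    have : C ∩ f ⁻¹' G i = C ∩ f ⁻¹' (⋃ j : {j // j ≠ i}, G j)ᶜ := by
      ext z
      refine and_congr_right fun hz => ⟨fun hi hj => ?_, fun h => ?_⟩
      · obtain ⟨j, hj⟩ := mem_iUnion.1 hj
        exact Set.disjoint_left.1 (hd j.2) hj hi
      · obtain ⟨j, hj⟩ := mem_iUnion.1 (hfS hz)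
        by_cases hij : j = i
        · exact hij ▸ hSG j hj
        · exact absurd (mem_iUnion.2 ⟨⟨j, hij⟩, hSG j hj⟩) h
    rw [this]
    exact hf.preimage_isClosed_of_isClosed hC
      (isOpen_iUnion fun j : {j // j ≠ i} => hG j).isClosed_compl
  choose U g hU hCU hg hgS hgf using fun i => hS i (C ∩ f ⁻¹' G i) f (hCi i)
    (hf.mono inter_subset_left) (fun z hz => hSi z hz.1 i hz.2)
  set O : ι → Set Z := fun i => {z | Metric.infEDist z (C ∩ f ⁻¹' G i) <
    Metric.infEDist z (C \ f ⁻¹' G i)}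
  have hO : ∀ i, IsOpen (O i) := fun i =>
    isOpen_lt Metric.continuous_infEDist Metric.continuous_infEDist
  have hsub : ∀ i j, i ≠ j → C ∩ f ⁻¹' G i ⊆ C \ f ⁻¹' G j := fun i j hij z hz =>
    ⟨hz.1, fun h => Set.disjoint_left.1 (hd hij) hz.2 h⟩
  have hOO : ∀ i j z, z ∈ O i → z ∈ O j → i = j := by
    intro i j z hi hj
    by_contra hij
    have h1 := Metric.infEDist_anti (x := z) (hsub i j hij)
    have h2 := Metric.infEDist_anti (x := z) (hsub j i (Ne.symm hij))
    exact lt_irrefl _ ((hi.trans_le h2).trans (hj.trans_le h1))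
  have hCO : ∀ i, C ∩ f ⁻¹' G i ⊆ O i := by
    intro i z hz
    have hcl : IsClosed (C \ f ⁻¹' G i) := by
      have := hf.preimage_isClosed_of_isClosed hC (hG i).isClosed_compl
      rwa [preimage_compl, ← sdiff_eq] at this
    rw [mem_ofPred_eq, Metric.infEDist_zero_of_mem hz, pos_iff_ne_zero]
    exact fun h => ((Metric.mem_iff_infEDist_zero_of_closed hcl).2 h).2 hz.2
  set G' : Z → P := fun z => if h : ∃ i, z ∈ O i then g h.choose z else f z
  have hG' : ∀ i, EqOn G' (g i) (O i) := by
    intro i z hz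
    have h : ∃ i, z ∈ O i := ⟨i, hz⟩
    simp only [G', dif_pos h]
    rw [hOO _ _ z h.choose_spec hz]
  refine ⟨⋃ i, U i ∩ O i, G', isOpen_iUnion fun i => (hU i).inter (hO i), ?_, ?_, ?_, ?_⟩
  · intro z hz
    obtain ⟨i, hi⟩ := mem_iUnion.1 (hfS hz)
    exact mem_iUnion.2 ⟨i, hCU i ⟨hz, hSG i hi⟩, hCO i ⟨hz, hSG i hi⟩⟩
  · refine ContinuousOn.iUnion_of_isOpen (fun i => ?_) fun i => (hU i).inter (hO i)
    exact ((hg i).mono inter_subset_left).congr ((hG' i).mono inter_subset_right)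
  · intro z hz
    obtain ⟨i, hi⟩ := mem_iUnion.1 hz
    rw [hG' i hi.2]
    exact mem_iUnion.2 ⟨i, hgS i hi.1⟩
  · intro z hz
    obtain ⟨i, hi⟩ := mem_iUnion.1 (hfS hz)
    rw [hG' i (hCO i ⟨hz, hSG i hi⟩), hgf i ⟨hz, hSG i hi⟩]

end Extensor

/-! ### Countable covers -/

section Cover

variable {Z : Type*} {P : Type*} [TopologicalSpace P]

theorem isClosed_iUnion_Icc_two_mul_add (b : ℝ) :
    IsClosed (⋃ i : ℕ, Icc (2 * (i : ℝ) + b) (2 * (i : ℝ) + b + 1)) := by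
  refine LocallyFinite.isClosed_iUnion (fun x => ⟨Iio (x + 1), Iio_mem_nhds (lt_add_one x), ?_⟩)
    fun i => isClosed_Icc
  obtain ⟨N, hN⟩ := exists_nat_gt (x + 1 - b)
  refine (finite_lt_nat N).subset ?_
  rintro i ⟨y, hy, hy'⟩
  have h1 := hy.1
  have h2 : y < x + 1 := hy'
  have h3 : (0 : ℝ) ≤ i := i.cast_nonneg
  have : (i : ℝ) < N := by linarith
  exact_mod_cast this

/-- A telescope argument: a continuous `u` bounds the stage `V i` needed at each point of `C`, and
`(f, u)` is extended instead of `f`. Over the intervals `[m, m + 1]` with `m` of one parity the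
target is a disjoint union of products `(S ∩ V (m + 1)) × window`; the two parities form a closed
decomposition of the source. -/
theorem IsNbhdExtensor.of_monotone_cover [PseudoEMetricSpace Z] {S : Set P} {V : ℕ → Set P}
    (hV : ∀ i, IsOpen (V i)) (hmono : Monotone V) (hcov : S ⊆ ⋃ i, V i)
    (hS : ∀ i, IsNbhdExtensor Z (S ∩ V i)) : IsNbhdExtensor Z S := by
  intro C f hC hf hfS
  choose G hG hGC using fun i => continuousOn_iff'.1 hf (V i) (hV i)
  -- The constraints on `u z` are convex and locally solved by a constant: near a point of `C` sent
  -- into `V i` the value `i + 1` works by monotonicity. A partition of unity makes the choice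
  -- continuous.
  obtain ⟨u, hu⟩ := exists_continuous_forall_mem_convex_of_local_const (X := Z) (E := ℝ)
    (t := fun z => Ici 1 ∩ ⋂ i : ℕ, ⋂ _ : z ∈ C ∧ f z ∉ V i, Ici ((i : ℝ) + 1))
    (fun z => (convex_Ici 1).inter (convex_iInter fun i => convex_iInter fun _ => convex_Ici _))
    (by
      intro z
      by_cases hz : z ∈ C
      · obtain ⟨i, hi⟩ := mem_iUnion.1 (hcov (hfS hz))
        refine ⟨i + 1, ?_⟩
        have hzG : z ∈ G i := ((hGC i).subset ⟨hi, hz⟩).1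
        filter_upwards [(hG i).mem_nhds hzG] with y hy
        refine ⟨by simp, mem_iInter.2 fun j => mem_iInter.2 fun hj => ?_⟩
        have hji : j ≤ i := by
          by_contra hij
          exact hj.2 (hmono (not_le.1 hij).le ((hGC i).symm.subset ⟨hy, hj.1⟩).1)
        have : (j : ℝ) ≤ i := by exact_mod_cast hji
        simpa using this
      · refine ⟨1, ?_⟩
        filter_upwards [hC.isOpen_compl.mem_nhds hz] with y hy
        exact ⟨by simp, mem_iInter.2 fun j => mem_iInter.2 fun hj => absurd hj.1 hy⟩)
  have hu1 : ∀ z, 1 ≤ u z := fun z => (hu z).1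
  have huV : ∀ z ∈ C, ∀ i : ℕ, u z < i + 1 → f z ∈ V i := by
    intro z hz i hi
    by_contra h
    exact not_le.2 hi (mem_iInter.1 (mem_iInter.1 (hu z).2 i) ⟨hz, h⟩)
  have hprod : ∀ (i : ℕ) (a b : ℝ),
      IsNbhdExtensor Z ({x : P × ℝ | x.1 ∈ S ∩ V i} ∩ Prod.snd ⁻¹' Ioo a b) :=
    fun i a b => (hS i).prod_univ.inter_isOpen (isOpen_Ioo.preimage continuous_snd)
  have hunion : ∀ (e : ℕ → ℕ) (a b : ℕ → ℝ), (∀ i j, i < j → b i ≤ a j) →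
      IsNbhdExtensor Z (⋃ i, {x : P × ℝ | x.1 ∈ S ∩ V (e i)} ∩ Prod.snd ⁻¹' Ioo (a i) (b i)) := by
    intro e a b hab
    refine IsNbhdExtensor.iUnion_disjoint (G := fun i => Prod.snd ⁻¹' Ioo (a i) (b i))
      (fun i => hprod _ _ _) (fun i => isOpen_Ioo.preimage continuous_snd)
      (fun i => inter_subset_right) ?_
    have key : ∀ i j, i < j → Disjoint ((Prod.snd : P × ℝ → ℝ) ⁻¹' Ioo (a i) (b i))
        (Prod.snd ⁻¹' Ioo (a j) (b j)) := by
      intro i j hij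
      rw [Set.disjoint_left]
      rintro x ⟨-, h1⟩ ⟨h2, -⟩
      exact not_lt.2 (hab i j hij) (h2.trans h1)
    intro i j hij
    rcases lt_or_gt_of_ne hij with h | h
    · exact key i j h
    · exact (key j i h).symm
  -- The window extends `[m, m + 1]` by `1 / 4` on both sides. Its length `3 / 2` is less than the
  -- spacing `2`, so windows of one parity are disjoint.
  have piece : ∀ (c : ℕ), IsNbhdExtensor Z (⋃ i : ℕ, {x : P × ℝ | x.1 ∈ S ∩ V (2 * i + c + 1)} ∩
      Prod.snd ⁻¹' Ioo (2 * (i : ℝ) + c - 1 / 4) (2 * (i : ℝ) + c + 5 / 4)) := by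
    intro c
    refine hunion (fun i => 2 * i + c + 1) _ _ fun i j hij => ?_
    have : (i : ℝ) + 1 ≤ j := by exact_mod_cast hij
    linarith
  have hmem : ∀ (c : ℕ) (m : ℕ) (x : P × ℝ), (∃ i, m = 2 * i + c) → x.1 ∈ S → x.1 ∈ V (m + 1) →
      (m : ℝ) - 1 / 4 < x.2 → x.2 < m + 5 / 4 →
      x ∈ (⋃ i : ℕ, {x : P × ℝ | x.1 ∈ S ∩ V (2 * i + c + 1)} ∩
      Prod.snd ⁻¹' Ioo (2 * (i : ℝ) + c - 1 / 4) (2 * (i : ℝ) + c + 5 / 4)) := by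
    rintro c _ x ⟨i, rfl⟩ h1 h2 h3 h4
    push_cast at h3 h4
    exact mem_iUnion.2 ⟨i, ⟨h1, h2⟩, h3, h4⟩
  have hcover : ∀ (c : ℕ), MapsTo (fun z => (f z, u z))
      (C ∩ u ⁻¹' ⋃ i : ℕ, Icc (2 * (i : ℝ) + c) (2 * (i : ℝ) + c + 1))
      (⋃ i : ℕ, {x : P × ℝ | x.1 ∈ S ∩ V (2 * i + c + 1)} ∩
        Prod.snd ⁻¹' Ioo (2 * (i : ℝ) + c - 1 / 4) (2 * (i : ℝ) + c + 5 / 4)) := by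
    rintro c z ⟨hz, hz'⟩
    obtain ⟨i, hi⟩ := mem_iUnion.1 hz'
    have h1 := hi.1
    have h2 := hi.2
    refine hmem c (2 * i + c) _ ⟨i, rfl⟩ (hfS hz) (huV z hz _ ?_) ?_ ?_ <;> push_cast <;> linarith
  -- On the overlap `u` is an integer `m + 1`, so `S₀` uses windows of radius `1 / 4` about these
  -- integers, each lying in a window of either parity.
  obtain ⟨U, g, hU, hCU, hg, hgS, hgf⟩ := exists_extension_of_decomposition
    (S₀ := ⋃ m : ℕ, {x : P × ℝ | x.1 ∈ S ∩ V (m + 1)} ∩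
      Prod.snd ⁻¹' Ioo ((m : ℝ) + 3 / 4) ((m : ℝ) + 5 / 4))
    (hunion (fun m => m + 1) _ _ fun i j hij => by
      have : (i : ℝ) + 1 ≤ j := by exact_mod_cast hij
      linarith) (piece 0) (piece 1)
    (by
      intro x hx
      obtain ⟨m, ⟨h1, h2⟩, h3, h4⟩ := mem_iUnion.1 hx
      rcases Nat.even_or_odd' m with ⟨i, hi | hi⟩
      · exact hmem 0 m x ⟨i, by omega⟩ h1 h2 (by linarith) (by linarith)
      · exact hmem 0 (m + 1) x ⟨i + 1, by omega⟩ h1 (hmono (Nat.le_succ _) h2)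
          (by push_cast; linarith) (by push_cast; linarith))
    (by
      intro x hx
      obtain ⟨m, ⟨h1, h2⟩, h3, h4⟩ := mem_iUnion.1 hx
      rcases Nat.even_or_odd' m with ⟨i, hi | hi⟩
      · exact hmem 1 (m + 1) x ⟨i, by omega⟩ h1 (hmono (Nat.le_succ _) h2)
          (by push_cast; linarith) (by push_cast; linarith)
      · exact hmem 1 m x ⟨i, by omega⟩ h1 h2 (by linarith) (by linarith))
    hC ((isClosed_iUnion_Icc_two_mul_add (0 : ℕ)).preimage u.continuous)
    ((isClosed_iUnion_Icc_two_mul_add (1 : ℕ)).preimage u.continuous)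
    (by
      refine eq_univ_of_forall fun z => ?_
      have h1 := Nat.floor_le (zero_le_one.trans (hu1 z))
      have h2 := Nat.lt_floor_add_one (u z)
      rcases Nat.even_or_odd' ⌊u z⌋₊ with ⟨i, hi | hi⟩
      · rw [hi] at h1 h2
        push_cast at h1 h2
        exact Or.inl (mem_iUnion.2 ⟨i, by push_cast; linarith, by push_cast; linarith⟩)
      · rw [hi] at h1 h2
        push_cast at h1 h2
        exact Or.inr (mem_iUnion.2 ⟨i, by push_cast; linarith, by push_cast; linarith⟩))
    (f := fun z => (f z, u z)) (hf.prodMk u.continuous.continuousOn)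
    (by
      rintro z ⟨hz, h1, h2⟩
      obtain ⟨i, hi1, hi2⟩ := mem_iUnion.1 h1
      obtain ⟨j, hj1, hj2⟩ := mem_iUnion.1 h2
      push_cast at hi1 hi2 hj1 hj2
      have a1 : (2 * i : ℝ) ≤ (2 * j + 2 : ℕ) := by push_cast; linarith
      have a2 : (2 * j + 1 : ℝ) ≤ (2 * i + 1 : ℕ) := by push_cast; linarith
      have b1 : 2 * i ≤ 2 * j + 2 := by exact_mod_cast a1
      have b2 : 2 * j + 1 ≤ 2 * i + 1 := by exact_mod_cast a2
      have hm : ∃ m : ℕ, u z = m + 1 := by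
        have : i = j ∨ i = j + 1 := by omega
        rcases this with rfl | rfl
        · exact ⟨2 * i, by push_cast; linarith⟩
        · exact ⟨2 * j + 1, by push_cast at *; linarith⟩
      obtain ⟨m, hm⟩ := hm
      refine mem_iUnion.2 ⟨m, ⟨hfS hz, huV z hz _ ?_⟩, ?_, ?_⟩ <;> push_cast <;> linarith)
    (hcover 0) (hcover 1)
  refine ⟨U, fun z => (g z).1, hU, hCU, continuous_fst.comp_continuousOn hg, fun z hz => ?_,
    fun z hz => congrArg Prod.fst (hgf hz)⟩
  rcases hgS hz with h | h
  · obtain ⟨i, hi⟩ := mem_iUnion.1 h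
    exact hi.1.1
  · obtain ⟨i, hi⟩ := mem_iUnion.1 h
    exact hi.1.1

theorem IsNbhdExtensor.of_countable_cover [PseudoEMetricSpace Z] {S : Set P} {O : ℕ → Set P}
    (hO : ∀ i, IsOpen (O i)) (hcov : S ⊆ ⋃ i, O i) (hS : ∀ i, IsNbhdExtensor Z (S ∩ O i)) :
    IsNbhdExtensor Z S := by
  have hV : ∀ i, IsOpen (Set.accumulate O i) := fun i => by
    rw [Set.accumulate_def]
    exact isOpen_biUnion fun j _ => hO j
  refine IsNbhdExtensor.of_monotone_cover hV Set.monotone_accumulate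
    (by rwa [Set.iUnion_accumulate]) fun i => ?_
  induction i with
  | zero => rw [Set.accumulate_zero_nat]; exact hS 0
  | succ i ih =>
    rw [Set.accumulate_succ]
    exact ih.union_inter_isOpen (hS (i + 1)) (hV i) (hO (i + 1))

/-- Being a neighbourhood extensor is a local property. -/
theorem IsNbhdExtensor.of_local [PseudoEMetricSpace Z] [SecondCountableTopology P] {S : Set P}
    (hS : ∀ x ∈ S, ∃ O, IsOpen O ∧ x ∈ O ∧ IsNbhdExtensor Z (S ∩ O)) : IsNbhdExtensor Z S := by
  classical
  choose! O hO hxO hSO using hS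
  obtain ⟨t, htS, htc, ht⟩ := TopologicalSpace.countable_cover_nhdsWithin
    (fun x hx => mem_nhdsWithin_of_mem_nhds ((hO x hx).mem_nhds (hxO x hx)))
  rcases t.eq_empty_or_nonempty with rfl | hne
  · have : S = ∅ := by simpa using ht
    rw [this]
    exact IsNbhdExtensor.empty
  · obtain ⟨e, rfl⟩ := htc.exists_eq_range hne
    exact IsNbhdExtensor.of_countable_cover (O := fun i => O (e i))
      (fun i => hO _ (htS (mem_range_self i))) (by simpa using ht)
      fun i => hSO _ (htS (mem_range_self i))

end Cover

/-! ### Manifolds with cylinders are neighbourhood extensors -/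

section Manifolds

/-- Project linearly onto `e + L`. In a half-space, if `ℓ` is nonzero somewhere on `L`, push along a
vector of `L` just far enough to make `ℓ` nonnegative; otherwise `ℓ` is constant on `e + L`, with
the value `ℓ e ≥ 0`. -/
theorem exists_retraction_of_isBoundaryModel {E : Type*} [NormedAddCommGroup E] [NormedSpace ℝ E]
    [FiniteDimensional ℝ E] {H : Type*} [TopologicalSpace H] {I : ModelWithCorners ℝ E H}
    (hI : IsBoundaryModel I) (L : Submodule ℝ E) {e : E} (he : e ∈ range I) :
    ∃ ρ : E → E, Continuous ρ ∧ (∀ y, ρ y ∈ range I ∧ ρ y - e ∈ L) ∧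
      ∀ y ∈ range I, y - e ∈ L → ρ y = y := by
  obtain ⟨π, hπ, hπL, hπe⟩ : ∃ π : E → E, Continuous π ∧ (∀ v, π v ∈ L) ∧ ∀ v ∈ L, π v = v := by
    obtain ⟨q, hq⟩ := L.subtype.exists_leftInverse_of_injective L.ker_subtype
    refine ⟨fun v => q v, continuous_subtype_val.comp q.continuous_of_finiteDimensional,
      fun v => (q v).2, fun v hv => ?_⟩
    simpa using congrArg Subtype.val (LinearMap.congr_fun hq ⟨v, hv⟩)
  have hp : Continuous fun y => e + π (y - e) :=
    continuous_const.add (hπ.comp (continuous_id.sub continuous_const))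
  have hpL : ∀ y, e + π (y - e) - e ∈ L := fun y => by
    rw [add_sub_cancel_left]
    exact hπL _
  have hpe : ∀ y, y - e ∈ L → e + π (y - e) = y := fun y hy => by
    rw [hπe _ hy, add_sub_cancel]
  rcases hI with hI | ⟨ℓ, -, hI⟩
  · exact ⟨_, hp, fun y => ⟨by rw [hI]; trivial, hpL y⟩, fun y _ hy => hpe y hy⟩
  · rw [hI] at he ⊢
    by_cases hL : ∃ v ∈ L, ℓ v ≠ 0
    · obtain ⟨v, hv, hℓ⟩ := hL
      refine ⟨fun y => (e + π (y - e)) + (max 0 (-ℓ (e + π (y - e))) / ℓ v) • v, ?_,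
        fun y => ⟨?_, ?_⟩, fun y hy hy' => ?_⟩
      · exact hp.add (((continuous_const.max (ℓ.continuous.comp hp).neg).div_const _).smul
          continuous_const)
      · rw [mem_ofPred_eq, map_add ℓ (e + π (y - e)), map_smul, smul_eq_mul, div_mul_cancel₀ _ hℓ]
        linarith [le_max_right 0 (-ℓ (e + π (y - e)))]
      · dsimp only
        rw [add_sub_right_comm]
        exact L.add_mem (hpL y) (L.smul_mem _ hv)
      · have hy0 : 0 ≤ ℓ y := hy
        dsimp only
        rw [hpe y hy', max_eq_left (neg_nonpos.2 hy0), zero_div, zero_smul, add_zero]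
    · push Not at hL
      refine ⟨_, hp, fun y => ⟨?_, hpL y⟩, fun y _ hy => hpe y hy⟩
      rw [mem_ofPred_eq, map_add, hL _ (hπL _), add_zero]
      exact he

variable {E : Type*} [NormedAddCommGroup E] [NormedSpace ℝ E]
  {H : Type*} [TopologicalSpace H] {I : ModelWithCorners ℝ E H}
  {M : Type*} [TopologicalSpace M] [ChartedSpace H M]

theorem isClosed_box {k : ℕ} {A : Set (M × (Fin k → ℝ))} (hA : IsClosed A) (a b : ℝ) :
    IsClosed {x : M × (Fin (k + 1) → ℝ) |
      (x.1, Fin.init x.2) ∈ A ∧ x.2 (Fin.last k) ∈ Icc a b} := by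
  refine IsClosed.inter (hA.preimage (f := fun x : M × (Fin (k + 1) → ℝ) => (x.1, Fin.init x.2))
    ?_) (isClosed_Icc.preimage (f := fun x : M × (Fin (k + 1) → ℝ) => x.2 (Fin.last k)) ?_)
  · exact continuous_fst.prodMk (Continuous.finInit continuous_snd)
  · fun_prop

/-- The last coordinate is extended by Tietze and then clamped to `[a, b]`. Degenerate intervals
give the slices at heights `0` and `1`. -/
theorem IsNbhdExtensor.box {Z : Type*} [TopologicalSpace Z] [NormalSpace Z] {k : ℕ}
    {A : Set (M × (Fin k → ℝ))} (hA : IsNbhdExtensor Z A) {a b : ℝ} (hab : a ≤ b) :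
    IsNbhdExtensor Z {x : M × (Fin (k + 1) → ℝ) |
      (x.1, Fin.init x.2) ∈ A ∧ x.2 (Fin.last k) ∈ Icc a b} := by
  intro C f hC hf hfS
  have h2 := continuous_snd.comp_continuousOn hf
  obtain ⟨U, g, hU, hCU, hg, hgS, hgf⟩ := hA C (fun z => ((f z).1, Fin.init (f z).2)) hC
    ((continuous_fst.comp_continuousOn hf).prodMk
      ((Continuous.finInit continuous_id).comp_continuousOn h2)) fun z hz => (hfS hz).1
  obtain ⟨l, hl, hlf⟩ := exists_continuous_eqOn (W := ℝ) hC (f := fun z => (f z).2 (Fin.last k))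
    ((continuous_apply _).comp_continuousOn h2)
  refine ⟨U, fun z => ((g z).1, Fin.snoc (g z).2 (projIcc a b hab (l z) : ℝ)), hU, hCU, ?_, ?_, ?_⟩
  · refine (continuous_fst.comp_continuousOn hg).prodMk ?_
    intro z hz
    exact Filter.Tendsto.finSnoc ((continuous_snd.comp_continuousOn hg) z hz)
      ((continuous_subtype_val.comp (continuous_projIcc.comp hl)).continuousWithinAt)
  · intro z hz
    refine ⟨?_, ?_⟩
    · simpa using hgS hz
    · simp only [Fin.snoc_last]
      exact (projIcc a b hab (l z)).2
  · intro z hz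
    have e1 := hgf hz
    have e2 : (projIcc a b hab (l z) : ℝ) = (f z).2 (Fin.last k) := by
      rw [hlf hz, projIcc_of_mem hab (hfS hz).2]
    simp only [e2, e1, Fin.snoc_init_self]

theorem cyl_eq_union {M : Type*} {k : ℕ} (X A : Set (M × (Fin k → ℝ))) :
    cyl X A =
      {x : M × (Fin (k + 1) → ℝ) | (x.1, Fin.init x.2) ∈ X ∧ x.2 (Fin.last k) ∈ Icc (0 : ℝ) 0} ∪
      {x : M × (Fin (k + 1) → ℝ) | (x.1, Fin.init x.2) ∈ A ∧ x.2 (Fin.last k) ∈ Icc (0 : ℝ) 1} := by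
  rw [Icc_self]
  rfl

theorem top_eq {M : Type*} {k : ℕ} (D : Set (M × (Fin k → ℝ))) :
    top D =
      {x : M × (Fin (k + 1) → ℝ) | (x.1, Fin.init x.2) ∈ D ∧ x.2 (Fin.last k) ∈ Icc (1 : ℝ) 1} := by
  rw [Icc_self]
  rfl

theorem isClosed_cyl {k : ℕ} {X A : Set (M × (Fin k → ℝ))} (hX : IsClosed X) (hA : IsClosed A) :
    IsClosed (cyl X A) := by
  rw [cyl_eq_union]
  exact (isClosed_box hX 0 0).union (isClosed_box hA 0 1)

theorem isClosed_top {k : ℕ} {D : Set (M × (Fin k → ℝ))} (hD : IsClosed D) :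
    IsClosed (top D) := by
  rw [top_eq]
  exact isClosed_box hD 1 1

theorem IsNbhdExtensor.cyl {Z : Type*} [PseudoEMetricSpace Z] {k : ℕ}
    {X A : Set (M × (Fin k → ℝ))} (hX : IsNbhdExtensor Z X) (hA : IsNbhdExtensor Z A)
    (hXc : IsClosed X) (hAc : IsClosed A) (hAX : A ⊆ X) : IsNbhdExtensor Z (cyl X A) := by
  rw [cyl_eq_union]
  refine (hX.box le_rfl).union_isClosed (hA.box zero_le_one) ?_ (isClosed_box hXc 0 0)
    (isClosed_box hAc 0 1)
  convert hA.box (le_refl (0 : ℝ)) using 1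
  ext x
  constructor
  · rintro ⟨h1, h2⟩
    exact ⟨h2.1, h1.2⟩
  · rintro ⟨h1, h2⟩
    exact ⟨⟨hAX h1, h2⟩, h1, h2.1, h2.2.trans zero_le_one⟩

theorem IsNbhdExtensor.cyl_union_top {Z : Type*} [PseudoEMetricSpace Z] {k : ℕ}
    {X A D : Set (M × (Fin k → ℝ))} (hX : IsNbhdExtensor Z X) (hA : IsNbhdExtensor Z A)
    (hD : IsNbhdExtensor Z D) (hXc : IsClosed X) (hAc : IsClosed A) (hDc : IsClosed D)
    (hAX : A ⊆ X) (hAD : A ⊆ D) : IsNbhdExtensor Z (DiffHEP.cyl X A ∪ top D) := by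
  refine (hX.cyl hA hXc hAc hAX).union_isClosed (by rw [top_eq]; exact hD.box le_rfl) ?_
    (isClosed_cyl hXc hAc) (isClosed_top hDc)
  convert hA.box (le_refl (1 : ℝ)) using 1
  rw [Icc_self]
  ext x
  constructor
  · rintro ⟨⟨-, h0⟩ | ⟨h1, -⟩, -, h2⟩
    · exact absurd (h0.symm.trans h2) zero_ne_one
    · exact ⟨h1, h2⟩
  · rintro ⟨h1, h2⟩
    have h2 : x.2 (Fin.last k) = 1 := h2
    exact ⟨Or.inr ⟨h1, by simp [h2]⟩, hAD h1, h2⟩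

theorem IsManifoldWithCylinders.isClosed {k : ℕ} {X : Set (M × (Fin k → ℝ))}
    (hX : IsManifoldWithCylinders I k X) : IsClosed X := by
  induction hX with
  | base N hN => exact hN.1.preimage continuous_fst
  | cyl k X A _ _ _ hX hA => exact isClosed_cyl hX hA
  | cylTop k X A D _ _ _ _ _ hX hA hD => exact (isClosed_cyl hX hA).union (isClosed_top hD)

variable [FiniteDimensional ℝ E]

/-- In a chart, extend the coordinate expression of the map to the whole source by Tietze, retract
onto the flat model of `N`, and return to `M` where the result lies in the chart target. -/
theorem IsNeatSubmanifold.isNbhdExtensor (hI : IsBoundaryModel I) [SecondCountableTopology M]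
    {Z : Type*} [PseudoEMetricSpace Z] {N : Set M} (hN : IsNeatSubmanifold I N) :
    IsNbhdExtensor Z N := by
  refine IsNbhdExtensor.of_local fun x hx => ?_
  obtain ⟨φ, -, hxφ, L, hL, -⟩ := hN.2 x hx
  refine ⟨φ.source, φ.open_source, hxφ, fun C f hC hf hfS => ?_⟩
  obtain ⟨ρ, hρ, hρm, hρe⟩ := exists_retraction_of_isBoundaryModel hI L
    (e := φ.extend I x) (mem_range_self _)
  have hφ : ContinuousOn (φ.extend I) φ.source := by
    have := φ.continuousOn_extend (I := I)
    rwa [φ.extend_source] at this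
  have : TietzeExtension E := TietzeExtension.of_tvs ℝ
  obtain ⟨g, hg, hgf⟩ := exists_continuous_eqOn hC
    (hφ.comp hf fun z hz => (hfS hz).2)
  have hρg : Continuous fun z => ρ (g z) := hρ.comp hg
  have hgf' : ∀ z ∈ C, ρ (g z) = φ.extend I (f z) := fun z hz => by
    rw [hgf hz]
    exact hρe _ (mem_range_self _) ((hL _ (hfS hz).2).1 (hfS hz).1)
  have hU : ∀ z, I.symm (ρ (g z)) ∈ φ.target → ρ (g z) ∈ (φ.extend I).target := fun z hz => by
    rw [φ.extend_target]
    exact ⟨hz, (hρm _).1⟩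
  refine ⟨(fun z => I.symm (ρ (g z))) ⁻¹' φ.target, fun z => (φ.extend I).symm (ρ (g z)),
    φ.open_target.preimage (I.continuous_symm.comp hρg), fun z hz => ?_,
    (φ.continuousOn_extend_symm (I := I)).comp hρg.continuousOn hU, fun z hz => ?_,
    fun z hz => ?_⟩
  · have h1 : φ.extend I (f z) ∈ (φ.extend I).target :=
      (φ.extend I).map_source (by rw [φ.extend_source]; exact (hfS hz).2)
    rw [φ.extend_target] at h1
    rw [mem_preimage, hgf' z hz]
    exact h1.1
  · have hs : (φ.extend I).symm (ρ (g z)) ∈ φ.source := by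
      have := (φ.extend I).map_target (hU z hz)
      rwa [φ.extend_source] at this
    refine ⟨(hL _ hs).2 ?_, hs⟩
    rw [(φ.extend I).right_inv (hU z hz)]
    exact (hρm _).2
  · change (φ.extend I).symm (ρ (g z)) = f z
    rw [hgf' z hz, φ.extend_left_inv (hfS hz).2]

theorem IsManifoldWithCylinders.isNbhdExtensor (hI : IsBoundaryModel I)
    [SecondCountableTopology M] {Z : Type*} [PseudoEMetricSpace Z] {k : ℕ}
    {X : Set (M × (Fin k → ℝ))} (hX : IsManifoldWithCylinders I k X) : IsNbhdExtensor Z X := by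
  induction hX with
  | base N hN =>
    intro C f hC hf hfS
    obtain ⟨U, g, hU, hCU, hg, hgS, hgf⟩ := hN.isNbhdExtensor hI C (fun z => (f z).1) hC
      (continuous_fst.comp_continuousOn hf) hfS
    exact ⟨U, fun z => (g z, default), hU, hCU, hg.prodMk continuousOn_const, hgS,
      fun z hz => Prod.ext (hgf hz) (Subsingleton.elim _ _)⟩
  | cyl k X A hXm hAm hAX hX hA => exact hX.cyl hA hXm.isClosed hAm.isClosed hAX
  | cylTop k X A D hXm hAm hDm hAX hAD hX hA hD =>
    exact hX.cyl_union_top hA hD hXm.isClosed hAm.isClosed hDm.isClosed hAX hAD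

/-- The homotopy extension property for continuous maps. -/
theorem exists_continuousMap_extension (hI : IsBoundaryModel I) [T2Space M]
    [SecondCountableTopology M] {Y : Type*} [TopologicalSpace Y] {k : ℕ}
    {X A : Set (M × (Fin k → ℝ))} (hX : IsManifoldWithCylinders I k X)
    (hA : IsManifoldWithCylinders I k A) (hAX : A ⊆ X) (f : C(cyl X A, Y)) :
    ∃ F : C(prodI X, Y), ∀ x, F (inclusion (cyl_subset_prodI hAX) x) = f x := by
  have := I.locallyCompactSpace
  have := ChartedSpace.locallyCompactSpace H M
  let := TopologicalSpace.metrizableSpaceMetric M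
  have hext : IsNbhdExtensor (M × (Fin (k + 1) → ℝ)) (cyl X A) :=
    (IsManifoldWithCylinders.cyl k X A hX hA hAX).isNbhdExtensor hI
  obtain ⟨U, r, hU, hCU, hr, hrS, hre⟩ := hext (cyl X A) id
    (isClosed_cyl hX.isClosed hA.isClosed) continuousOn_id (mapsTo_id _)
  have hsnoc : Continuous fun x : (M × (Fin k → ℝ)) × ℝ =>
      ((x.1.1, Fin.snoc x.1.2 x.2) : M × (Fin (k + 1) → ℝ)) :=
    (continuous_fst.comp continuous_fst).prodMk
      (Continuous.finSnoc (continuous_snd.comp continuous_fst) continuous_snd)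
  set W : Set (M × (Fin k → ℝ)) :=
    {p | ∀ t ∈ Icc (0 : ℝ) 1, ((p.1, Fin.snoc p.2 t) : M × (Fin (k + 1) → ℝ)) ∈ U} with hW
  -- Tube lemma: openness follows from compactness of `[0, 1]`.
  have hWo : IsOpen W := by
    rw [isOpen_iff_mem_nhds]
    intro p hp
    exact isCompact_Icc.eventually_forall_of_forall_eventually fun t ht =>
      hsnoc.continuousAt.eventually (hU.mem_nhds (hp t ht))
  have hAW : A ⊆ W := fun p hp t ht => hCU (Or.inr ⟨by simpa using hp, by simpa using ht⟩)
  obtain ⟨u, hu0, hu1, hu⟩ := exists_continuous_zero_one_of_isClosed hWo.isClosed_compl hA.isClosed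
    (disjoint_compl_left.mono_right hAW)
  set b : M × (Fin (k + 1) → ℝ) → M × (Fin k → ℝ) := fun x => (x.1, Fin.init x.2) with hb
  have hbc : Continuous b := continuous_fst.prodMk (Continuous.finInit continuous_snd)
  set s : M × (Fin (k + 1) → ℝ) → M × (Fin (k + 1) → ℝ) := fun x =>
    (x.1, Fin.snoc (Fin.init x.2) (x.2 (Fin.last k) * u (b x))) with hs
  have hsc : Continuous s := by
    refine hsnoc.comp (hbc.prodMk (Continuous.mul ?_ (u.continuous.comp hbc)))
    fun_prop
  -- Over `W` the whole fibre lies in `U`; off `W` the factor is zero and the point lands in `X ×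
  -- {0}`.
  have hsU : ∀ x ∈ prodI X, s x ∈ U := by
    intro x hx
    by_cases hxW : b x ∈ W
    · exact hxW _ ⟨mul_nonneg hx.2.1 (hu _).1, mul_le_one₀ hx.2.2 (hu _).1 (hu _).2⟩
    · refine hCU (Or.inl ⟨by simpa [hs] using hx.1, ?_⟩)
      have : u (b x) = 0 := hu0 hxW
      simp [hs, this]
  refine ⟨⟨fun x => f ⟨r (s x), hrS (hsU x x.2)⟩, f.continuous.comp (Continuous.subtype_mk ?_ _)⟩,
    fun x => ?_⟩
  · exact hr.comp_continuous (hsc.comp continuous_subtype_val) fun x => hsU x x.2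
  · have hsx : s x = x := by
      rcases x.2 with ⟨-, h0⟩ | ⟨hxA, -⟩
      · refine Prod.ext rfl ?_
        change Fin.snoc (Fin.init x.1.2) (x.1.2 (Fin.last k) * u (b x)) = x.1.2
        rw [h0, zero_mul, ← h0, Fin.snoc_init_self]
      · have : u (b x) = 1 := hu1 hxA
        refine Prod.ext rfl ?_
        change Fin.snoc (Fin.init x.1.2) (x.1.2 (Fin.last k) * u (b x)) = x.1.2
        rw [this, mul_one, Fin.snoc_init_self]
    change f ⟨r (s x), _⟩ = f x
    congr 1
    apply Subtype.ext
    change r (s x) = x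
    rw [hsx]
    exact hre x.2

end Manifolds

/-! ### Alternating sums over simplicial identities -/

section AlternatingSums

variable {W : Type*} [AddCommGroup W]

theorem neg_one_pow_succ_add_zsmul (i j : ℕ) (w : W) :
    (-1 : ℤ) ^ (i + 1 + j) • w = -((-1 : ℤ) ^ (i + j) • w) := by
  rw [add_right_comm, pow_succ, mul_neg_one, neg_smul]

/-- The alternating sum of all iterated faces vanishes. -/
theorem sum_alternating_faces_eq_zero (n : ℕ) (a : ℕ → ℕ → W)
    (h : ∀ i j, j ≤ i → i < n → a (i + 1) j = a j i) :
    ∑ i ∈ Finset.range (n + 1), ∑ j ∈ Finset.range n, (-1 : ℤ) ^ (i + j) • a i j = 0 := by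
  have h1 : ∀ i ∈ Finset.range (n + 1), ∑ j ∈ Finset.range n, (-1 : ℤ) ^ (i + j) • a i j =
      ∑ j ∈ Finset.range i, (-1 : ℤ) ^ (i + j) • a i j +
      ∑ j ∈ Finset.Ico i n, (-1 : ℤ) ^ (i + j) • a i j := fun i hi =>
    (Finset.sum_range_add_sum_Ico _ (Nat.lt_succ_iff.1 (Finset.mem_range.1 hi))).symm
  rw [Finset.sum_congr rfl h1, Finset.sum_add_distrib, Finset.sum_range_succ',
    Finset.sum_range_succ (fun i => ∑ j ∈ Finset.Ico i n, (-1 : ℤ) ^ (i + j) • a i j)]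
  simp only [Finset.range_zero, Finset.sum_empty, add_zero, Finset.Ico_self]
  rw [Finset.sum_comm' (s := Finset.range n) (t := fun i => Finset.Ico i n)
    (t' := Finset.range n) (s' := fun j => Finset.range (j + 1))
    (by intro i j; simp only [Finset.mem_range, Finset.mem_Ico]; omega),
    ← Finset.sum_add_distrib]
  -- The entries below the diagonal, shifted by one row, cancel those on and above it: the index sum
  -- changes parity.
  refine Finset.sum_eq_zero fun i hi => ?_
  rw [← Finset.sum_add_distrib]
  refine Finset.sum_eq_zero fun j hj => ?_
  rw [neg_one_pow_succ_add_zsmul, h i j (Nat.lt_succ_iff.1 (Finset.mem_range.1 hj))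
    (Finset.mem_range.1 hi), add_comm j i, neg_add_cancel]

/-- The alternating sum of the faces of the simplices of a prism. -/
theorem sum_alternating_prism (n : ℕ) (a b : ℕ → ℕ → W)
    (h₁ : ∀ i j, j ≤ i → i < n → a (i + 1) j = b i j)
    (h₂ : ∀ i j, i < j → j ≤ n → a i (j + 1) = b i j)
    (h₃ : ∀ i, i < n → a (i + 1) (i + 1) = a i (i + 1)) :
    ∑ i ∈ Finset.range (n + 1), ∑ j ∈ Finset.range (n + 2), (-1 : ℤ) ^ (i + j) • a i j +
      ∑ i ∈ Finset.range n, ∑ j ∈ Finset.range (n + 1), (-1 : ℤ) ^ (i + j) • b i j =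
      a 0 0 - a n (n + 1) := by
  -- In each row the entries `j < i` and `j > i + 1` are side faces, which cancel against `b`. The
  -- two central ones, of opposite sign, telescope by `h₃` to the two ends of the prism.
  have row : ∀ i ∈ Finset.range (n + 1),
      ∑ j ∈ Finset.range (n + 2), (-1 : ℤ) ^ (i + j) • a i j =
      (∑ j ∈ Finset.range i, (-1 : ℤ) ^ (i + j) • a i j) + (a i i - a i (i + 1)) -
      ∑ j ∈ Finset.Ico (i + 1) (n + 1), (-1 : ℤ) ^ (i + j) • b i j := by
    intro i hi
    have hi : i < n + 1 := Finset.mem_range.1 hi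
    rw [← Finset.sum_range_add_sum_Ico _ (show i + 2 ≤ n + 2 by omega), Finset.sum_range_succ,
      Finset.sum_range_succ, ← Finset.sum_Ico_add' _ (i + 1) (n + 1) 1]
    have e : ∀ j ∈ Finset.Ico (i + 1) (n + 1), (-1 : ℤ) ^ (i + (j + 1)) • a i (j + 1) =
        -((-1 : ℤ) ^ (i + j) • b i j) := by
      intro j hj
      rw [Finset.mem_Ico] at hj
      rw [h₂ i j (by omega) (by omega), ← add_assoc, pow_succ, mul_neg_one, neg_smul]
    rw [Finset.sum_congr rfl e, Finset.sum_neg_distrib, ← add_assoc i i 1, pow_succ, ← two_mul,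
      pow_mul]
    simp only [even_two, Even.neg_pow, one_pow, mul_neg_one, neg_smul, one_smul]
    abel
  rw [Finset.sum_congr rfl row, Finset.sum_sub_distrib, Finset.sum_add_distrib,
    Finset.sum_range_succ' (fun i => ∑ j ∈ Finset.range i, (-1 : ℤ) ^ (i + j) • a i j),
    Finset.sum_range_succ (fun i => ∑ j ∈ Finset.Ico (i + 1) (n + 1), (-1 : ℤ) ^ (i + j) • b i j),
    Finset.sum_range_succ (fun i => a i i - a i (i + 1))]
  have e1 : ∀ i ∈ Finset.range n, a i i - a i (i + 1) = a i i - a (i + 1) (i + 1) := fun i hi => by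
    rw [h₃ i (Finset.mem_range.1 hi)]
  have e2 : ∀ i ∈ Finset.range n, ∑ j ∈ Finset.range (i + 1), (-1 : ℤ) ^ (i + 1 + j) • a (i + 1) j =
      -∑ j ∈ Finset.range (i + 1), (-1 : ℤ) ^ (i + j) • b i j := by
    intro i hi
    rw [← Finset.sum_neg_distrib]
    refine Finset.sum_congr rfl fun j hj => ?_
    rw [neg_one_pow_succ_add_zsmul, h₁ i j (Nat.lt_succ_iff.1 (Finset.mem_range.1 hj))
      (Finset.mem_range.1 hi)]
  have e3 : ∀ i ∈ Finset.range n, ∑ j ∈ Finset.range (n + 1), (-1 : ℤ) ^ (i + j) • b i j =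
      ∑ j ∈ Finset.range (i + 1), (-1 : ℤ) ^ (i + j) • b i j +
      ∑ j ∈ Finset.Ico (i + 1) (n + 1), (-1 : ℤ) ^ (i + j) • b i j := fun i hi =>
    (Finset.sum_range_add_sum_Ico _ (by have := Finset.mem_range.1 hi; omega)).symm
  rw [Finset.sum_congr rfl e1, Finset.sum_range_sub' (fun i => a i i), Finset.sum_congr rfl e2,
    Finset.sum_congr rfl e3, Finset.sum_add_distrib, Finset.sum_neg_distrib]
  simp only [Finset.range_zero, Finset.sum_empty, add_zero, Finset.Ico_self]
  abel

/-- The coboundary of a cochain that is concentrated in one degree. -/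
def delta {Simp : ℕ → Type*} (face : ∀ p : ℕ, Fin (p + 2) → Simp (p + 1) → Simp p) {p : ℕ}
    (c : Simp p → W) (σ : Simp (p + 1)) : W :=
  ∑ i : Fin (p + 2), ((-1 : ℤ) ^ (i : ℕ)) • c (face p i σ)

theorem delta_sub {Simp : ℕ → Type*} (face : ∀ p : ℕ, Fin (p + 2) → Simp (p + 1) → Simp p)
    {p : ℕ} (c c' : Simp p → W) (σ : Simp (p + 1)) :
    delta face (fun τ => c τ - c' τ) σ = delta face c σ - delta face c' σ := by
  simp only [delta, smul_sub, Finset.sum_sub_distrib]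

/-- Passing to natural-number indices, with the junk value `0` out of range, removes dependent-index
bookkeeping from the cancellations. -/
theorem sum_fin_sum_fin_zsmul {m n : ℕ} (u : Fin m → Fin n → W) :
    ∑ i : Fin m, (-1 : ℤ) ^ (i : ℕ) • ∑ j : Fin n, (-1 : ℤ) ^ (j : ℕ) • u i j =
      ∑ i ∈ Finset.range m, ∑ j ∈ Finset.range n, (-1 : ℤ) ^ (i + j) •
        if h : i < m ∧ j < n then u ⟨i, h.1⟩ ⟨j, h.2⟩ else 0 := by
  rw [Finset.sum_range]
  refine Finset.sum_congr rfl fun i _ => ?_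
  rw [Finset.sum_range, Finset.smul_sum]
  refine Finset.sum_congr rfl fun j _ => ?_
  rw [dif_pos ⟨i.2, j.2⟩, smul_smul, pow_add]

theorem delta_delta {Simp : ℕ → Type*} (face : ∀ p : ℕ, Fin (p + 2) → Simp (p + 1) → Simp p)
    (hface : ∀ (p : ℕ) (i j : Fin (p + 2)), j ≤ i → ∀ σ : Simp (p + 2),
      face p j (face (p + 1) i.succ σ) = face p i (face (p + 1) j.castSucc σ))
    {p : ℕ} (c : Simp p → W) (σ : Simp (p + 2)) : delta face (delta face c) σ = 0 := by
  unfold delta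
  rw [sum_fin_sum_fin_zsmul (fun i j => c (face p j (face (p + 1) i σ)))]
  refine sum_alternating_faces_eq_zero (p + 2) _ fun i j hj hi => ?_
  rw [dif_pos ⟨by omega, by omega⟩, dif_pos ⟨by omega, hi⟩]
  exact congrArg c (hface p ⟨i, hi⟩ ⟨j, by omega⟩ hj σ)

end AlternatingSums

/-! ### The contraction of the last coordinate -/

section Shrink

/-- The contraction of the last coordinate by the factor `s`. -/
def shrink {M : Type*} {k : ℕ} (s : ℝ) (x : M × (Fin (k + 1) → ℝ)) : M × (Fin (k + 1) → ℝ) :=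
  (x.1, fun l => (if l = Fin.last k then s else 1) * x.2 l)

theorem shrink_one {M : Type*} {k : ℕ} (x : M × (Fin (k + 1) → ℝ)) : shrink 1 x = x := by
  simp [shrink]

theorem shrink_last {M : Type*} {k : ℕ} (s : ℝ) (x : M × (Fin (k + 1) → ℝ)) :
    (shrink s x).2 (Fin.last k) = s * x.2 (Fin.last k) := by
  simp [shrink]

theorem init_shrink {M : Type*} {k : ℕ} (s : ℝ) (x : M × (Fin (k + 1) → ℝ)) :
    Fin.init (shrink s x).2 = Fin.init x.2 := by
  funext l
  simp [shrink, Fin.init, (Fin.castSucc_lt_last l).ne]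

theorem shrink_mem_prodI {M : Type*} {k : ℕ} {X : Set (M × (Fin k → ℝ))}
    {x : M × (Fin (k + 1) → ℝ)} (hx : x ∈ prodI X) {s : ℝ} (hs : s ∈ Icc (0 : ℝ) 1) :
    shrink s x ∈ prodI X := by
  refine ⟨by rw [init_shrink]; exact hx.1, ?_⟩
  rw [shrink_last]
  exact ⟨mul_nonneg hs.1 hx.2.1, mul_le_one₀ hs.2 hx.2.1 hx.2.2⟩

theorem shrink_mem_cyl {M : Type*} {k : ℕ} {X A : Set (M × (Fin k → ℝ))}
    {x : M × (Fin (k + 1) → ℝ)} (hx : x ∈ cyl X A) {s : ℝ} (hs : s ∈ Icc (0 : ℝ) 1) :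
    shrink s x ∈ cyl X A := by
  rcases hx with ⟨hx, h0⟩ | ⟨hx, h1⟩
  · exact Or.inl ⟨by rw [init_shrink]; exact hx, by rw [shrink_last, h0, mul_zero]⟩
  · refine Or.inr ⟨by rw [init_shrink]; exact hx, ?_⟩
    rw [shrink_last]
    exact ⟨mul_nonneg hs.1 h1.1, mul_le_one₀ hs.2 h1.1 h1.2⟩

theorem shrink_zero_mem_cyl {M : Type*} {k : ℕ} {X A : Set (M × (Fin k → ℝ))}
    {x : M × (Fin (k + 1) → ℝ)} (hx : x ∈ prodI X) : shrink 0 x ∈ cyl X A :=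
  Or.inl ⟨by rw [init_shrink]; exact hx.1, by rw [shrink_last, zero_mul]⟩

open Classical in
/-- The sum of the barycentric coordinates with index in `Q`. -/
noncomputable def weight {p : ℕ} (Q : Set (Fin (p + 1))) (z : stdSimplex ℝ (Fin (p + 1))) : ℝ :=
  ∑ m, if m ∈ Q then z m else 0

theorem weight_mem {p : ℕ} (Q : Set (Fin (p + 1))) (z : stdSimplex ℝ (Fin (p + 1))) :
    weight Q z ∈ Icc (0 : ℝ) 1 := by
  classical
  constructor
  · exact Finset.sum_nonneg fun m _ => by split_ifs <;> simp
  · rw [← stdSimplex.sum_eq_one z]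
    exact Finset.sum_le_sum fun m _ => by split_ifs <;> simp

theorem weight_univ {p : ℕ} (z : stdSimplex ℝ (Fin (p + 1))) : weight univ z = 1 := by
  simp [weight]

theorem weight_empty {p : ℕ} (z : stdSimplex ℝ (Fin (p + 1))) : weight ∅ z = 0 := by
  simp [weight]

/-- An affine map of simplices sums barycentric coordinates over the fibres of its vertex map. Hence
a face of a shrunk simplex is again shrunk, along the preimage of `Q`. -/
theorem weight_map {p r : ℕ} (g : Fin (p + 1) → Fin (r + 1)) (Q : Set (Fin (r + 1)))
    (z : stdSimplex ℝ (Fin (p + 1))) : weight Q (stdSimplex.map g z) = weight (g ⁻¹' Q) z := by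
  classical
  simp only [weight, stdSimplex.map_coe, FunOnFinite.linearMap_apply_apply, mem_preimage]
  rw [← Finset.sum_fiberwise Finset.univ g fun a => if g a ∈ Q then z a else 0]
  refine Finset.sum_congr rfl fun m _ => ?_
  split_ifs with hm
  · refine Finset.sum_congr rfl fun a ha => ?_
    rw [(Finset.mem_filter.1 ha).2, if_pos hm]
  · refine (Finset.sum_eq_zero fun a ha => ?_).symm
    rw [(Finset.mem_filter.1 ha).2, if_neg hm]

theorem continuous_weight {p : ℕ} (Q : Set (Fin (p + 1))) : Continuous (weight Q) := by
  classical
  unfold weight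
  refine continuous_finsetSum _ fun m _ => ?_
  split_ifs
  · exact (continuous_apply m).comp continuous_subtype_val
  · exact continuous_const

theorem contDiff_baryVec {p : ℕ} : ContDiff ℝ ∞ (baryVec : (Fin p → ℝ) → Fin (p + 1) → ℝ) := by
  rw [contDiff_pi]
  intro j
  refine Fin.cases ?_ (fun j => ?_) j
  · simp only [baryVec, Fin.cons_zero]
    fun_prop
  · simp only [baryVec, Fin.cons_succ]
    fun_prop

/-- The affine map of standard simplices given by a map of vertices, in Cartesian coordinates. -/
noncomputable def cornerMap {p r : ℕ} (g : Fin (p + 1) → Fin (r + 1)) (t : Fin p → ℝ) : Fin r → ℝ :=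
  fun j => FunOnFinite.linearMap ℝ ℝ g (baryVec t) j.succ

theorem contDiff_cornerMap {p r : ℕ} (g : Fin (p + 1) → Fin (r + 1)) :
    ContDiff ℝ ∞ (cornerMap g) := by
  rw [contDiff_pi]
  intro j
  have h : ContDiff ℝ ∞ (fun v => FunOnFinite.linearMap ℝ ℝ g v j.succ) :=
    (LinearMap.toContinuousLinearMap
      (LinearMap.proj j.succ ∘ₗ FunOnFinite.linearMap ℝ ℝ g)).contDiff
  exact h.comp contDiff_baryVec

theorem cornerMap_mem {p r : ℕ} (g : Fin (p + 1) → Fin (r + 1)) {t : Fin p → ℝ}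
    (ht : t ∈ corner p) : cornerMap g t ∈ corner r := by
  have h := stdSimplex.image_linearMap (S := ℝ) g ⟨_, baryVec_mem ht, rfl⟩
  refine ⟨fun j => h.1 _, ?_⟩
  have h2 := h.2
  rw [Fin.sum_univ_succ] at h2
  have h0 := h.1 0
  simp only [cornerMap]
  linarith

theorem map_bary {p r : ℕ} (g : Fin (p + 1) → Fin (r + 1)) {t : Fin p → ℝ} (ht : t ∈ corner p) :
    stdSimplex.map g (bary p t) = bary r (cornerMap g t) := by
  have h := stdSimplex.image_linearMap (S := ℝ) g ⟨_, baryVec_mem ht, rfl⟩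
  rw [bary_of_mem ht, bary_of_mem (cornerMap_mem g ht)]
  apply Subtype.ext
  change FunOnFinite.linearMap ℝ ℝ g (baryVec t) = baryVec (cornerMap g t)
  funext j
  refine Fin.cases ?_ (fun j => ?_) j
  · have h2 := h.2
    rw [Fin.sum_univ_succ] at h2
    simp only [baryVec, Fin.cons_zero, cornerMap]
    simp only [baryVec] at h2
    linarith
  · simp [baryVec, cornerMap]

theorem contDiffOn_weight_bary {p : ℕ} (Q : Set (Fin (p + 1))) :
    ContDiffOn ℝ ∞ (fun t => weight Q (bary p t)) (corner p) := by
  classical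
  have h : ContDiff ℝ ∞ fun t : Fin p → ℝ => ∑ m, if m ∈ Q then baryVec t m else 0 := by
    refine ContDiff.sum fun m _ => ?_
    split_ifs
    · exact contDiff_pi.1 contDiff_baryVec m
    · exact contDiff_const
  refine h.contDiffOn.congr fun t ht => ?_
  rw [bary_of_mem ht]
  rfl

end Shrink

/-! ### The prism operator on smooth simplices -/

theorem val_succAbove {n : ℕ} (i : Fin (n + 1)) (m : Fin n) :
    (i.succAbove m : ℕ) = if (m : ℕ) < i then (m : ℕ) else m + 1 := by
  simp only [Fin.succAbove, Fin.lt_def, Fin.val_castSucc]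
  split_ifs <;> rfl

theorem val_predAbove {n : ℕ} (i : Fin n) (m : Fin (n + 1)) :
    (i.predAbove m : ℕ) = if (i : ℕ) < m then (m : ℕ) - 1 else m := by
  simp only [Fin.predAbove, Fin.lt_def, Fin.val_castSucc]
  split_ifs <;> rfl

section Prism

variable {E : Type*} [NormedAddCommGroup E] [NormedSpace ℝ E]
  {H : Type*} [TopologicalSpace H] {I : ModelWithCorners ℝ E H}
  {M : Type*} [TopologicalSpace M] [ChartedSpace H M] {k : ℕ}

/-- The smooth simplex `z ↦ shrink (weight Q z) (σ (g z))` of `T`. -/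
noncomputable def SmoothSimplex.shrinkMap {S T : Set (M × (Fin (k + 1) → ℝ))} {p r : ℕ}
    (σ : SmoothSimplex I S r) (g : Fin (p + 1) → Fin (r + 1)) (Q : Set (Fin (p + 1)))
    (h : ∀ z, shrink (weight Q z) (σ.toMap (stdSimplex.map g z)).1 ∈ T) :
    SmoothSimplex I T p where
  toMap := ⟨fun z => ⟨shrink (weight Q z) (σ.toMap (stdSimplex.map g z)).1, h z⟩, by
    have hσ : Continuous fun z => (σ.toMap (stdSimplex.map g z)).1 :=
      continuous_subtype_val.comp (σ.toMap.continuous.comp (stdSimplex.continuous_map g))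
    refine Continuous.subtype_mk ((continuous_fst.comp hσ).prodMk (continuous_pi fun l => ?_)) _
    refine Continuous.mul ?_ ((continuous_apply l).comp (continuous_snd.comp hσ))
    split_ifs
    · exact continuous_weight Q
    · exact continuous_const⟩
  smooth_fst := by
    refine (σ.smooth_fst.comp (contDiff_cornerMap g).contMDiff.contMDiffOn
      (fun t ht => cornerMap_mem g ht)).congr fun t ht => ?_
    change (σ.toMap (stdSimplex.map g (bary p t))).1.1 = _
    rw [map_bary g ht]
    rfl
  smooth_snd := by
    rw [contDiffOn_pi]
    intro l
    have h2 : ContDiffOn ℝ ∞ (fun t => (σ.toMap (stdSimplex.map g (bary p t))).1.2 l)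
        (corner p) := by
      refine ((contDiffOn_pi.1 σ.smooth_snd l).comp (contDiff_cornerMap g).contDiffOn
        (fun t ht => cornerMap_mem g ht)).congr fun t ht => ?_
      rw [map_bary g ht]
      rfl
    refine ContDiffOn.mul (f := fun t => if l = Fin.last k then weight Q (bary p t) else 1) ?_ h2
    split_ifs
    · exact contDiffOn_weight_bary Q
    · exact contDiffOn_const

theorem SmoothSimplex.ext_val {k : ℕ} {S : Set (M × (Fin k → ℝ))} {p : ℕ}
    {σ τ : SmoothSimplex I S p}
    (h : ∀ z, (σ.toMap z).1 = (τ.toMap z).1) : σ = τ :=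
  SmoothSimplex.ext (ContinuousMap.ext fun z => Subtype.ext (h z))

theorem smoothFace_toMap {k : ℕ} (S : Set (M × (Fin k → ℝ))) (p : ℕ) (i : Fin (p + 2))
    (σ : SmoothSimplex I S (p + 1)) (z : stdSimplex ℝ (Fin (p + 1))) :
    (smoothFace I S p i σ).toMap z = σ.toMap (stdSimplex.map i.succAbove z) := rfl

variable {S T : Set (M × (Fin (k + 1) → ℝ))}

/-- With the two face formulas below, most prism identities become equalities of vertex maps and
vertex sets, decidable by integer arithmetic. -/
theorem shrinkMap_congr {p r : ℕ} {σ : SmoothSimplex I S r} {g g' : Fin (p + 1) → Fin (r + 1)}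
    {Q Q' : Set (Fin (p + 1))}
    (h : ∀ z, shrink (weight Q z) (σ.toMap (stdSimplex.map g z)).1 ∈ T)
    (h' : ∀ z, shrink (weight Q' z) (σ.toMap (stdSimplex.map g' z)).1 ∈ T)
    (hg : g = g') (hQ : Q = Q') : σ.shrinkMap g Q h = σ.shrinkMap g' Q' h' := by
  subst hg hQ
  rfl

theorem smoothFace_shrinkMap {p r : ℕ} (σ : SmoothSimplex I S r)
    (g : Fin (p + 2) → Fin (r + 1)) (Q : Set (Fin (p + 2)))
    (h : ∀ z, shrink (weight Q z) (σ.toMap (stdSimplex.map g z)).1 ∈ T) (i : Fin (p + 2))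
    (h' : ∀ z, shrink (weight (i.succAbove ⁻¹' Q) z)
      (σ.toMap (stdSimplex.map (g ∘ i.succAbove) z)).1 ∈ T) :
    smoothFace I T p i (σ.shrinkMap g Q h) =
      σ.shrinkMap (g ∘ i.succAbove) (i.succAbove ⁻¹' Q) h' := by
  refine SmoothSimplex.ext_val fun z => ?_
  change shrink (weight Q (stdSimplex.map i.succAbove z))
    (σ.toMap (stdSimplex.map g (stdSimplex.map i.succAbove z))).1 =
    shrink (weight (i.succAbove ⁻¹' Q) z) (σ.toMap (stdSimplex.map (g ∘ i.succAbove) z)).1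
  rw [weight_map, stdSimplex.map_comp_apply]

theorem shrinkMap_smoothFace {p r : ℕ} (σ : SmoothSimplex I S (r + 1))
    (g : Fin (p + 1) → Fin (r + 1)) (Q : Set (Fin (p + 1))) (i : Fin (r + 2))
    (h : ∀ z, shrink (weight Q z) ((smoothFace I S r i σ).toMap (stdSimplex.map g z)).1 ∈ T)
    (h' : ∀ z, shrink (weight Q z) (σ.toMap (stdSimplex.map (i.succAbove ∘ g) z)).1 ∈ T) :
    (smoothFace I S r i σ).shrinkMap g Q h = σ.shrinkMap (i.succAbove ∘ g) Q h' := by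
  refine SmoothSimplex.ext_val fun z => ?_
  change shrink (weight Q z)
    (σ.toMap (stdSimplex.map i.succAbove (stdSimplex.map g z))).1 =
    shrink (weight Q z) (σ.toMap (stdSimplex.map (i.succAbove ∘ g) z)).1
  rw [stdSimplex.map_comp_apply]

theorem smoothFace_smoothFace {k : ℕ} (S : Set (M × (Fin k → ℝ))) (p : ℕ) (i j : Fin (p + 2))
    (hij : j ≤ i) (σ : SmoothSimplex I S (p + 2)) :
    smoothFace I S p j (smoothFace I S (p + 1) i.succ σ) =
      smoothFace I S p i (smoothFace I S (p + 1) j.castSucc σ) := by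
  have h : i.succ.succAbove ∘ j.succAbove = j.castSucc.succAbove ∘ i.succAbove := by
    rw [Fin.le_def] at hij
    funext m
    simp only [Function.comp_apply, Fin.ext_iff, val_succAbove, Fin.val_castSucc, Fin.val_succ]
    split_ifs <;> omega
  refine SmoothSimplex.ext_val fun z => ?_
  simp only [smoothFace_toMap, stdSimplex.map_comp_apply, h]

/-- The top-dimensional simplices of the triangulated prism over `σ`. -/
noncomputable def prismSimplex (hS : ∀ x ∈ S, ∀ s ∈ Icc (0 : ℝ) 1, shrink s x ∈ S) {p : ℕ}
    (σ : SmoothSimplex I S p) (i : Fin (p + 1)) : SmoothSimplex I S (p + 1) :=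
  -- Vertices up to `i` lie at the collapsed end (factor `0`) and later ones at the original end
  -- (factor `1`); the degeneracy `i.predAbove` repeats vertex `i` of `σ`.
  σ.shrinkMap i.predAbove {m | i.castSucc < m} fun z => hS _ (σ.toMap _).2 _ (weight_mem _ z)

/-- The end of the contraction: all simplices are pushed to the zero slice. -/
noncomputable def collapse (hST : ∀ x ∈ S, shrink 0 x ∈ T) {p : ℕ} (σ : SmoothSimplex I S p) :
    SmoothSimplex I T p :=
  σ.shrinkMap id ∅ fun z => by rw [weight_empty]; exact hST _ (σ.toMap _).2

variable (hS : ∀ x ∈ S, ∀ s ∈ Icc (0 : ℝ) 1, shrink s x ∈ S)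

theorem smoothFace_prismSimplex_of_le {p : ℕ} (σ : SmoothSimplex I S (p + 1))
    (i : Fin (p + 1)) (j : Fin (p + 2)) (hij : (j : ℕ) ≤ i) :
    smoothFace I S (p + 1) j.castSucc (prismSimplex hS σ i.succ) =
      prismSimplex hS (smoothFace I S p j σ) i := by
  have h : ∀ {p r : ℕ} (τ : SmoothSimplex I S r) (g : Fin (p + 1) → Fin (r + 1)) (Q) (z),
      shrink (weight Q z) (τ.toMap (stdSimplex.map g z)).1 ∈ S :=
    fun τ g Q z => hS _ (τ.toMap _).2 _ (weight_mem _ z)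
  unfold prismSimplex
  rw [smoothFace_shrinkMap _ _ _ _ _ (h _ _ _), shrinkMap_smoothFace _ _ _ _ _ (h _ _ _)]
  apply shrinkMap_congr
  · funext m
    simp only [Function.comp_apply, Fin.ext_iff, val_succAbove, val_predAbove, Fin.val_castSucc,
      Fin.val_succ]
    split_ifs <;> omega
  · ext m
    simp only [mem_preimage, mem_ofPred_eq, Fin.lt_def, val_succAbove, Fin.val_castSucc,
      Fin.val_succ]
    split_ifs <;> omega

theorem smoothFace_prismSimplex_of_lt {p : ℕ} (σ : SmoothSimplex I S (p + 1))
    (i : Fin (p + 1)) (j : Fin (p + 2)) (hij : (i : ℕ) < j) :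
    smoothFace I S (p + 1) j.succ (prismSimplex hS σ i.castSucc) =
      prismSimplex hS (smoothFace I S p j σ) i := by
  have h : ∀ {p r : ℕ} (τ : SmoothSimplex I S r) (g : Fin (p + 1) → Fin (r + 1)) (Q) (z),
      shrink (weight Q z) (τ.toMap (stdSimplex.map g z)).1 ∈ S :=
    fun τ g Q z => hS _ (τ.toMap _).2 _ (weight_mem _ z)
  unfold prismSimplex
  rw [smoothFace_shrinkMap _ _ _ _ _ (h _ _ _), shrinkMap_smoothFace _ _ _ _ _ (h _ _ _)]
  apply shrinkMap_congr
  · funext m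
    simp only [Function.comp_apply, Fin.ext_iff, val_succAbove, val_predAbove, Fin.val_castSucc,
      Fin.val_succ]
    split_ifs <;> omega
  · ext m
    simp only [mem_preimage, mem_ofPred_eq, Fin.lt_def, val_succAbove, Fin.val_castSucc,
      Fin.val_succ]
    split_ifs <;> omega

/-- Consecutive prism simplices share this interior wall. -/
theorem smoothFace_prismSimplex_middle {p : ℕ} (σ : SmoothSimplex I S p) (i j : Fin (p + 1))
    (hij : (j : ℕ) = i + 1) :
    smoothFace I S p j.castSucc (prismSimplex hS σ j) =
      smoothFace I S p i.succ (prismSimplex hS σ i) := by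
  have h : ∀ {p r : ℕ} (τ : SmoothSimplex I S r) (g : Fin (p + 1) → Fin (r + 1)) (Q) (z),
      shrink (weight Q z) (τ.toMap (stdSimplex.map g z)).1 ∈ S :=
    fun τ g Q z => hS _ (τ.toMap _).2 _ (weight_mem _ z)
  unfold prismSimplex
  rw [smoothFace_shrinkMap _ _ _ _ _ (h _ _ _), smoothFace_shrinkMap _ _ _ _ _ (h _ _ _)]
  apply shrinkMap_congr
  · funext m
    simp only [Function.comp_apply, Fin.ext_iff, val_succAbove, val_predAbove, Fin.val_castSucc,
      Fin.val_succ]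
    split_ifs <;> omega
  · ext m
    simp only [mem_preimage, mem_ofPred_eq, Fin.lt_def, val_succAbove, Fin.val_castSucc,
      Fin.val_succ]
    split_ifs <;> omega

theorem smoothFace_prismSimplex_zero {p : ℕ} (σ : SmoothSimplex I S p) :
    smoothFace I S p 0 (prismSimplex hS σ 0) = σ := by
  refine SmoothSimplex.ext_val fun z => ?_
  change shrink (weight _ (stdSimplex.map (Fin.succAbove 0) z))
    (σ.toMap (stdSimplex.map _ (stdSimplex.map (Fin.succAbove 0) z))).1 = _
  rw [weight_map, stdSimplex.map_comp_apply]
  have h1 : (Fin.succAbove 0 : Fin (p + 1) → Fin (p + 2)) ⁻¹' {m | (0 : Fin (p + 1)).castSucc < m} =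
      univ := by
    ext m
    simp
  have h2 : (Fin.predAbove (0 : Fin (p + 1))) ∘ Fin.succAbove 0 = id := by
    funext m
    simp
  rw [h1, h2, weight_univ, shrink_one, stdSimplex.map_id_apply]

theorem smoothFace_prismSimplex_last (hS0 : ∀ x ∈ S, shrink 0 x ∈ S) {p : ℕ}
    (σ : SmoothSimplex I S p) :
    smoothFace I S p (Fin.last (p + 1)) (prismSimplex hS σ (Fin.last p)) = collapse hS0 σ := by
  unfold prismSimplex collapse
  rw [smoothFace_shrinkMap _ _ _ _ _ fun z => hS _ (σ.toMap _).2 _ (weight_mem _ z)]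
  apply shrinkMap_congr
  · funext m
    simp
  · ext m
    simp [Fin.lt_def]
    omega

variable {W : Type*} [AddCommGroup W]

/-- The dual of the prism operator. -/
noncomputable def prism {p : ℕ} (c : SmoothSimplex I S (p + 1) → W) (σ : SmoothSimplex I S p) : W :=
  ∑ i : Fin (p + 1), (-1 : ℤ) ^ (i : ℕ) • c (prismSimplex hS σ i)

/-- The chain homotopy formula in degree zero, where the prism over a point is one edge and the term
`δ K` is absent. -/
theorem prism_delta_zero (hS0 : ∀ x ∈ S, shrink 0 x ∈ S) (c : SmoothSimplex I S 0 → W)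
    (σ : SmoothSimplex I S 0) :
    prism hS (delta (smoothFace I S) c) σ = c σ - c (collapse hS0 σ) := by
  have h0 := smoothFace_prismSimplex_zero hS σ
  have h1 := smoothFace_prismSimplex_last hS hS0 σ
  simp only [prism, delta, Fin.sum_univ_succ, Finset.univ_eq_empty, Finset.sum_empty]
  have e : (Fin.last (0 + 1) : Fin 2) = Fin.succ 0 := rfl
  have e' : Fin.last 0 = 0 := rfl
  rw [e, e'] at h1
  rw [h0, h1]
  simp [sub_eq_add_neg]

/-- The dual prism operator is a cochain homotopy from pull-back along the collapse to the identity.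
-/
theorem prism_delta_succ (hS0 : ∀ x ∈ S, shrink 0 x ∈ S) {p : ℕ}
    (c : SmoothSimplex I S (p + 1) → W) (σ : SmoothSimplex I S (p + 1)) :
    prism hS (delta (smoothFace I S) c) σ + delta (smoothFace I S) (prism hS c) σ =
      c σ - c (collapse hS0 σ) := by
  have key := sum_alternating_prism (p + 1)
    (fun i j => if h : i < p + 2 ∧ j < p + 3 then
      c (smoothFace I S (p + 1) ⟨j, h.2⟩ (prismSimplex hS σ ⟨i, h.1⟩)) else 0)
    (fun i j => if h : j < p + 2 ∧ i < p + 1 then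
      c (prismSimplex hS (smoothFace I S p ⟨j, h.1⟩ σ) ⟨i, h.2⟩) else 0) ?_ ?_ ?_
  · unfold prism delta
    rw [sum_fin_sum_fin_zsmul fun i j => c (smoothFace I S (p + 1) j (prismSimplex hS σ i)),
      sum_fin_sum_fin_zsmul fun j i => c (prismSimplex hS (smoothFace I S p j σ) i),
      Finset.sum_comm (s := Finset.range (p + 2)) (t := Finset.range (p + 1))]
    refine Eq.trans (congrArg₂ _ rfl ?_) (key.trans ?_)
    · refine Finset.sum_congr rfl fun i _ => Finset.sum_congr rfl fun j _ => ?_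
      rw [add_comm j i]
    · rw [dif_pos ⟨by omega, by omega⟩, dif_pos ⟨by omega, by omega⟩]
      exact congrArg₂ (· - ·) (congrArg c (smoothFace_prismSimplex_zero hS σ))
        (congrArg c (smoothFace_prismSimplex_last hS hS0 σ))
  · intro i j hj hi
    rw [dif_pos ⟨by omega, by omega⟩, dif_pos ⟨by omega, hi⟩]
    exact congrArg c (smoothFace_prismSimplex_of_le hS σ ⟨i, hi⟩ ⟨j, by omega⟩ hj)
  · intro i j hj hi
    rw [dif_pos ⟨by omega, by omega⟩, dif_pos ⟨by omega, by omega⟩]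
    exact congrArg c (smoothFace_prismSimplex_of_lt hS σ ⟨i, by omega⟩ ⟨j, by omega⟩ hj)
  · intro i hi
    rw [dif_pos ⟨by omega, by omega⟩, dif_pos ⟨by omega, by omega⟩]
    exact congrArg c (smoothFace_prismSimplex_middle hS σ ⟨i, by omega⟩ ⟨i + 1, by omega⟩ rfl)

end Prism

/-! ### Extension of the cochain -/

section Extension

variable {E : Type*} [NormedAddCommGroup E] [NormedSpace ℝ E]
  {H : Type*} [TopologicalSpace H] {I : ModelWithCorners ℝ E H}
  {M : Type*} [TopologicalSpace M] [ChartedSpace H M] {k : ℕ} {W : Type*} [AddCommGroup W]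

theorem SmoothSimplex.incl_injective {S T : Set (M × (Fin k → ℝ))} (hST : S ⊆ T) {p : ℕ} :
    Function.Injective (SmoothSimplex.incl I hST : SmoothSimplex I S p → SmoothSimplex I T p) := by
  intro σ τ h
  refine SmoothSimplex.ext_val fun z => ?_
  exact congrArg (fun ρ : SmoothSimplex I T p => (ρ.toMap z).1) h

/-- Since `T` is stable under the contraction, the prism over a simplex of `T` stays in `T`. -/
theorem prism_eq_zero_of_incl {S T : Set (M × (Fin (k + 1) → ℝ))} (hTS : T ⊆ S)
    (hS : ∀ x ∈ S, ∀ s ∈ Icc (0 : ℝ) 1, shrink s x ∈ S)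
    (hT : ∀ x ∈ T, ∀ s ∈ Icc (0 : ℝ) 1, shrink s x ∈ T) {p : ℕ}
    {c : SmoothSimplex I S (p + 1) → W} (hc : ∀ τ : SmoothSimplex I T (p + 1), c (τ.incl I hTS) = 0)
    (σ : SmoothSimplex I T p) : prism hS c (σ.incl I hTS) = 0 :=
  Finset.sum_eq_zero fun i _ => by
    rw [show prismSimplex hS (σ.incl I hTS) i = (prismSimplex hT σ i).incl I hTS from rfl, hc,
      smul_zero]

/-- If `S` contracts into `T`, then a cochain `c` on `S` which is a cocycle and is the coboundary of
`h` on `T` is the coboundary of an extension of `h`. -/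
theorem exists_cochain_extension {S T : Set (M × (Fin (k + 1) → ℝ))} (hTS : T ⊆ S)
    (hS : ∀ x ∈ S, ∀ s ∈ Icc (0 : ℝ) 1, shrink s x ∈ S)
    (hT : ∀ x ∈ T, ∀ s ∈ Icc (0 : ℝ) 1, shrink s x ∈ T)
    (hST : ∀ x ∈ S, shrink 0 x ∈ T) {V : ℤ → Type*} [∀ q, AddCommGroup (V q)] {n : ℤ}
    (c : SmoothCochain I S V n) (h : SmoothCochain I T V (n - 1))
    (hc : ∀ (p : ℕ) (q : ℤ) (hpq : (p : ℤ) + q = n) (σ : SmoothSimplex I S (p + 1)),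
      delta (smoothFace I S) (c p q hpq) σ = 0)
    (hch : ∀ (p : ℕ) (q : ℤ) (hpq : (p : ℤ) + q = n) (σ : SmoothSimplex I T p),
      coboundary (smoothFace I T) h p q (by omega) σ = c p q hpq (σ.incl I hTS)) :
    ∃ h' : SmoothCochain I S V (n - 1),
      (∀ (p : ℕ) (q : ℤ) (hpq : (p : ℤ) + q = n - 1) (σ : SmoothSimplex I T p),
        h' p q hpq (σ.incl I hTS) = h p q hpq σ) ∧
      ∀ (p : ℕ) (q : ℤ) (hpq : (p : ℤ) + q = n) (σ : SmoothSimplex I S p),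
        coboundary (smoothFace I S) h' p q (by omega) σ = c p q hpq σ := by
  classical
  -- Extension by zero; smoothness imposes nothing on the values of a cochain, so no compatibility
  -- is needed.
  set e : SmoothCochain I S V (n - 1) := fun p q hpq σ =>
    if hσ : ∃ τ : SmoothSimplex I T p, τ.incl I hTS = σ then h p q hpq hσ.choose else 0 with he
  have he' : ∀ (p : ℕ) (q : ℤ) (hpq : (p : ℤ) + q = n - 1) (σ : SmoothSimplex I T p),
      e p q hpq (σ.incl I hTS) = h p q hpq σ := by
    intro p q hpq σ
    have hσ : ∃ τ : SmoothSimplex I T p, τ.incl I hTS = σ.incl I hTS := ⟨σ, rfl⟩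
    simp only [he, dif_pos hσ]
    rw [SmoothSimplex.incl_injective hTS hσ.choose_spec]
  set r : SmoothCochain I S V n := fun p q hpq σ =>
    c p q hpq σ - coboundary (smoothFace I S) e p q (by omega) σ with hr
  have hr0 : ∀ (p : ℕ) (q : ℤ) (hpq : (p : ℤ) + q = n) (σ : SmoothSimplex I T p),
      r p q hpq (σ.incl I hTS) = 0 := by
    intro p q hpq σ
    rw [hr, sub_eq_zero, ← hch]
    cases p with
    | zero => rfl
    | succ p =>
      exact Finset.sum_congr rfl fun i _ => congrArg _ (he' p q _ (smoothFace I T p i σ)).symm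
  have hrδ : ∀ (p : ℕ) (q : ℤ) (hpq : (p : ℤ) + q = n) (σ : SmoothSimplex I S (p + 1)),
      delta (smoothFace I S) (r p q hpq) σ = 0 := by
    intro p q hpq σ
    have h1 : delta (smoothFace I S) (r p q hpq) σ = delta (smoothFace I S) (c p q hpq) σ -
        delta (smoothFace I S) (coboundary (smoothFace I S) e p q (by omega)) σ :=
      delta_sub _ _ _ σ
    rw [h1, hc, zero_sub, neg_eq_zero]
    cases p with
    | zero => exact Finset.sum_eq_zero fun i _ => smul_zero _
    | succ p =>
      exact delta_delta (smoothFace I S) (fun p i j => smoothFace_smoothFace S p i j)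
        (e p q (by push_cast at hpq; omega)) σ
  have hS0 : ∀ x ∈ S, shrink 0 x ∈ S := fun x hx => hTS (hST x hx)
  -- The collapse factors through `T`, where `r` vanishes.
  have hrc : ∀ (p : ℕ) (q : ℤ) (hpq : (p : ℤ) + q = n) (σ : SmoothSimplex I S p),
      r p q hpq (collapse hS0 σ) = 0 := fun p q hpq σ => hr0 p q hpq (collapse hST σ)
  have hprism0 : ∀ (p : ℕ) (q : ℤ) (hpq : (p : ℤ) + q = n) (σ : SmoothSimplex I S p),
      prism hS (delta (smoothFace I S) (r p q hpq)) σ = 0 := fun p q hpq σ =>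
    Finset.sum_eq_zero fun i _ => by rw [hrδ, smul_zero]
  refine ⟨fun p q hpq σ => e p q hpq σ +
    prism hS (r (p + 1) q (by push_cast; omega)) σ, fun p q hpq σ => ?_, fun p q hpq σ => ?_⟩
  · dsimp only
    rw [he', prism_eq_zero_of_incl hTS hS hT (hr0 _ _ _), add_zero]
  · cases p with
    | zero =>
      -- In degree zero every coboundary is `0`, so the claim is `r = 0`: being a cocycle, `r` is
      -- constant along the contraction, and it vanishes at the end.
      have h1 := prism_delta_zero hS hS0 (r 0 q hpq) σ
      rw [hprism0, hrc, sub_zero] at h1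
      have h2 : r 0 q hpq σ = c 0 q hpq σ := sub_zero _
      rw [← h2, ← h1]
      rfl
    | succ p =>
      have h1 := prism_delta_succ hS hS0 (r (p + 1) q hpq) σ
      rw [hprism0, hrc, sub_zero, zero_add] at h1
      have h2 : coboundary (smoothFace I S) (fun p q hpq σ => e p q hpq σ +
          prism hS (r (p + 1) q (by push_cast; omega)) σ) (p + 1) q (by omega) σ =
          coboundary (smoothFace I S) e (p + 1) q (by omega) σ +
            delta (smoothFace I S) (prism hS (r (p + 1) q hpq)) σ := by
        simp only [coboundary, delta, smul_add, Finset.sum_add_distrib]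
      rw [h2, h1]
      exact add_sub_cancel _ _

theorem delta_pullbackCochain {Y : Type*} [TopologicalSpace Y] {V : ℤ → Type*}
    [∀ q, AddCommGroup (V q)] {n : ℤ} {κ : SingularCochain Y V n} (hκ : IsSingularCocycle κ)
    {S : Set (M × (Fin k → ℝ))} (f : C(S, Y)) (p : ℕ) (q : ℤ) (hpq : (p : ℤ) + q = n)
    (σ : SmoothSimplex I S (p + 1)) :
    delta (smoothFace I S) (pullbackCochain I f κ p q hpq) σ = 0 :=
  hκ (p + 1) q (by push_cast; omega) (f.comp σ.toMap)

/-- The defining equation gives `χ(ω) = δ h + f^* κ`, a sum of two cocycles. -/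
theorem DifferentialFunction.delta_chi [FiniteDimensional ℝ E] {Y : Type*} [TopologicalSpace Y]
    {V : ℤ → Type*} [∀ q, AddCommGroup (V q)] [∀ q, Module ℝ (V q)] {n : ℤ} {κ : SingularCochain Y V n}
    (hκ : IsSingularCocycle κ) {S : Set (M × (Fin k → ℝ))} (D : DifferentialFunction I S κ)
    (p : ℕ) (q : ℤ) (hpq : (p : ℤ) + q = n) (σ : SmoothSimplex I S (p + 1)) :
    delta (smoothFace I S) (chi I S D.curv p q hpq) σ = 0 := by
  have h1 : chi I S D.curv p q hpq = fun τ =>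
      coboundary (smoothFace I S) D.h p q (by omega) τ + pullbackCochain I D.f κ p q hpq τ := by
    funext τ
    rw [D.coboundary_eq p q hpq, sub_add_cancel]
  have h2 : delta (smoothFace I S) (chi I S D.curv p q hpq) σ =
      delta (smoothFace I S) (coboundary (smoothFace I S) D.h p q (by omega)) σ +
      delta (smoothFace I S) (pullbackCochain I D.f κ p q hpq) σ := by
    rw [h1]
    simp only [delta, smul_add, Finset.sum_add_distrib]
  rw [h2, delta_pullbackCochain hκ, add_zero]
  cases p with
  | zero => exact Finset.sum_eq_zero fun i _ => smul_zero _
  | succ p =>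
    exact delta_delta (smoothFace I S) (fun p i j => smoothFace_smoothFace S p i j)
      (D.h p q (by push_cast at hpq; omega)) σ

end Extension

end DiffHEP

/-! ### Assembly of the extended differential function -/

theorem lemma4p1
    {E : Type*} [NormedAddCommGroup E] [NormedSpace ℝ E] [FiniteDimensional ℝ E]
    {H : Type*} [TopologicalSpace H] (I : ModelWithCorners ℝ E H)
    (hI : DiffHEP.IsBoundaryModel I)
    {M : Type*} [TopologicalSpace M] [ChartedSpace H M] [IsManifold I ∞ M]
    [T2Space M] [SecondCountableTopology M]
    {Y : Type*} [TopologicalSpace Y]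
    {V : ℤ → Type*} [∀ q, AddCommGroup (V q)] [∀ q, Module ℝ (V q)]
    {n : ℤ} (κ : DiffHEP.SingularCochain Y V n) (hκ : DiffHEP.IsSingularCocycle κ)
    {k : ℕ} (X A : Set (M × (Fin k → ℝ)))
    (hX : DiffHEP.IsManifoldWithCylinders I k X)
    (hA : DiffHEP.IsManifoldWithCylinders I k A) (hAX : A ⊆ X)
    (D : DiffHEP.DifferentialFunction I (DiffHEP.cyl X A) κ) :
    ∃ G : DiffHEP.DifferentialFunction I (DiffHEP.prodI X) κ,
      (∀ x : DiffHEP.cyl X A,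
        G.f (Set.inclusion (DiffHEP.cyl_subset_prodI hAX) x) = D.f x) ∧
      (∀ (p : ℕ) (q : ℤ) (hpq : (p : ℤ) + q = n - 1)
        (σ : DiffHEP.SmoothSimplex I (DiffHEP.cyl X A) p),
        G.h p q hpq (σ.incl I (DiffHEP.cyl_subset_prodI hAX)) = D.h p q hpq σ) ∧
      G.curv = D.curv := by
  obtain ⟨F, hF⟩ := DiffHEP.exists_continuousMap_extension hI hX hA hAX D.f
  obtain ⟨h, hh, hδ⟩ := DiffHEP.exists_cochain_extension (DiffHEP.cyl_subset_prodI hAX)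
    (fun x hx s hs => DiffHEP.shrink_mem_prodI hx hs)
    (fun x hx s hs => DiffHEP.shrink_mem_cyl hx hs)
    (fun x hx => DiffHEP.shrink_zero_mem_cyl hx)
    (fun p q hpq σ => DiffHEP.chi I (DiffHEP.prodI X) D.curv p q hpq σ -
      DiffHEP.pullbackCochain I F κ p q hpq σ) D.h
    (fun p q hpq σ => by
      -- `χ(ω)` is known to be a cocycle only over `cyl X A`. Collapsing `σ` moves it there without
      -- changing its projection to `M`, hence without changing the integrals over its faces.
      have h1 := D.delta_chi hκ p q hpq
        (DiffHEP.collapse (fun x hx => DiffHEP.shrink_zero_mem_cyl hx) σ)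
      have h2 := DiffHEP.delta_pullbackCochain hκ F p q hpq σ
      have h3 : DiffHEP.delta (DiffHEP.smoothFace I (DiffHEP.prodI X))
          (DiffHEP.chi I (DiffHEP.prodI X) D.curv p q hpq) σ = 0 := by
        rw [← h1]
        refine Finset.sum_congr rfl fun i _ => congrArg _ ?_
        refine congrArg (DiffHEP.integralForm I (D.curv p q hpq)) (funext fun z => ?_)
        change (σ.toMap _).1.1 = (σ.toMap (stdSimplex.map id _)).1.1
        rw [stdSimplex.map_id_apply]
      refine (DiffHEP.delta_sub _ _ _ σ).trans ?_
      rw [h2, h3, sub_zero])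
    (fun p q hpq σ => by
      rw [D.coboundary_eq p q hpq σ]
      refine congrArg₂ (· - ·) rfl (congrArg (κ p q hpq) (ContinuousMap.ext fun z => ?_))
      exact (hF (σ.toMap z)).symm)
  exact ⟨⟨F, h, D.curv, hδ⟩, hF, hh, rfl⟩
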